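/- Let $q\ge 2$. There is a constant $C>0$ depending only on $q$ such that for every $p\ge 1$ and every $\sigma>0$ there is a constant $C_{\mathrm{CFL}}>0$ depending only on $p$, $q$ and $\sigma$ with the following property. Let $d\in\{1,2,3\}$, let $\Omega\subset\mathbb R^d$ be a polytopic domain (open and connected) with a finite conforming simplicial partition $\mathcal T_h$ that is shape-regular with parameter $\sigma$ (each $K\in\mathcal T_h$ contains a ball of diameter $h_K/\sigma$, where $h_K=\operatorname{diam}K$), and put $h_{\min}=\min_{K\in\mathcal T_h}h_K$. Let $c>0$, $T>0$, and let $0=t_0<t_1<\dots<t_N=T$ be any partition of $(0,T)$, with $I_n=(t_{n-1},t_n)$, $Q_n=\Omega\times I_n$ and $\tau=\max_n(t_n-t_{n-1})$. Let $f\in L^1(0,T;L^2(\Omega))$ (for instance $f\in L^2(\Omega\times(0,T))$), $u_0\in H_0^1(\Omega)$ and $v_0\in L^2(\Omega)$. Let $V_h=\{v\in H_0^1(\Omega): v|_K\in\mathbb P_p(K)\ \forall K\in\mathcal T_h\}$, and let $V_{h\tau}$ be the space of functions $v$ of time with values in $V_h$ such that $v|_{I_n}\in\mathbb P_q(I_n)\otimes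 V_h$ for $n=1,\dots,N$ (no continuity in time is imposed). For $v\in V_{h\tau}$ write $v(t_n^\pm)$ for one-sided limits, $[\![v]\!]_n=v(t_n^+)-v(t_n^-)$, $\partial_\tau v$ for the broken time derivative, $v(0)=v(0^+)$, and $$|v|_{\mathsf J}^2=\|v(T^-)\|_{L^2(\Omega)}^2+\sum_{n=1}^{N-1}\|[\![v]\!]_n\|_{L^2(\Omega)}^2+\|v(0^+)\|_{L^2(\Omega)}^2,$$ with the same notation for $\partial_\tau v$ and $\nabla v$. Consider the scheme: find $u_{h\tau}\in V_{h\tau}$ such that, for all $w\in V_{h\tau}$, $$\begin{aligned}&\sum_{n=1}^N(\partial_{tt}u_{h\tau},\partial_t w)_{Q_n}+\sum_{n=1}^{N-1}([\![\partial_t u_{h\tau}]\!]_n,\partial_t w(t_n^+))_\Omega+(\partial_t u_{h\tau}(0),\partial_t w(0))_\Omega\\&\quad+c^2\sum_{n=1}^N(\nabla u_{h\tau},\nabla\partial_t w)_{Q_n}+c^2\sum_{n=1}^{N-1}([\![\nabla u_{h\tau}]\!]_n,\nabla w(t_n^+))_\Omega+c^2(\nabla u_{h\tau}(0),\nabla w(0))_\Omega\\&=\sum_{n=1}^N(f,\partial_t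 w)_{Q_n}+(v_0,\partial_t w(0))_\Omega+c^2(\nabla u_0,\nabla w(0))_\Omega.\end{aligned}$$ If $\tau\le C_{\mathrm{CFL}}\,h_{\min}/c$, then every solution $u_{h\tau}$ satisfies $$\begin{aligned}&\|\partial_\tau u_{h\tau}\|_{L^\infty(0,T;L^2(\Omega))}^2+c^2\|\nabla u_{h\tau}\|_{L^\infty(0,T;L^2(\Omega)^d)}^2+|\partial_\tau u_{h\tau}|_{\mathsf J}^2+c^2|\nabla u_{h\tau}|_{\mathsf J}^2\\&\qquad\le C\left(\|f\|_{L^1(0,T;L^2(\Omega))}^2+\|v_0\|_{L^2(\Omega)}^2+c^2\|\nabla u_0\|_{L^2(\Omega)^d}^2\right).\end{aligned}$$ Moreover, under the same condition, the scheme has exactly one solution $u_{h\tau}\in V_{h\tau}$. -/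

import Mathlib

open Set Filter Topology MeasureTheory
open scoped ENNReal ContDiff

noncomputable section

namespace DGWave

/-- The spatial ambient space `ℝ^d` with its Euclidean norm. -/
abbrev Space (d : ℕ) := EuclideanSpace ℝ (Fin d)

/-! ### Function spaces in space -/

/-- `L²(Ω)`. -/
abbrev L2 {d : ℕ} (Ω : Set (Space d)) := Lp ℝ 2 (volume.restrict Ω)

/-- `L²(Ω)^d`. -/
abbrev L2Vec {d : ℕ} (Ω : Set (Space d)) := Lp (Space d) 2 (volume.restrict Ω)

/-- `H¹₀(Ω)`, realized as the closure in `L²(Ω) × L²(Ω)^d` of the pairs `(φ, ∇φ)` with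
`φ ∈ C_c^∞(Ω)`: its elements are the pairs `(v, ∇v)`, where `v` is a function in `H¹₀(Ω)` and `∇v` is
its weak gradient (which `v` determines). -/
def H10Submodule {d : ℕ} (Ω : Set (Space d)) : Submodule ℝ (L2 Ω × L2Vec Ω) :=
  (Submodule.span ℝ {z : L2 Ω × L2Vec Ω | ∃ φ : Space d → ℝ,
    ContDiff ℝ ∞ φ ∧ HasCompactSupport φ ∧ tsupport φ ⊆ Ω ∧
    z.1 =ᵐ[volume.restrict Ω] φ ∧ z.2 =ᵐ[volume.restrict Ω] gradient φ}).topologicalClosure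

/-- The space `H¹₀(Ω)`. -/
abbrev H10 {d : ℕ} (Ω : Set (Space d)) := ↥(H10Submodule Ω)

/-- The function `v ∈ L²(Ω)` underlying an element of `H¹₀(Ω)`. -/
def val {d : ℕ} {Ω : Set (Space d)} (v : H10 Ω) : L2 Ω := (v : L2 Ω × L2Vec Ω).1

/-- The weak gradient `∇v ∈ L²(Ω)^d` of `v ∈ H¹₀(Ω)`. -/
def grad {d : ℕ} {Ω : Set (Space d)} (v : H10 Ω) : L2Vec Ω := (v : L2 Ω × L2Vec Ω).2

/-! ### Space meshes and the conforming finite element space -/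

/-- The elements (`d`-simplices, given by their vertices) of a simplicial complex in `ℝ^d`. -/
def elements {d : ℕ} (𝒯 : Geometry.SimplicialComplex ℝ (Space d)) : Set (Finset (Space d)) :=
  {K | K ∈ 𝒯.faces ∧ K.card = d + 1}

/-- `𝒯` is a conforming simplicial partition of `Ω`. Conformity (two simplices meet in a common face
or not at all) is part of being a simplicial complex. -/
structure IsSimplicialPartition {d : ℕ} (Ω : Set (Space d))
    (𝒯 : Geometry.SimplicialComplex ℝ (Space d)) : Prop where
  finite : 𝒯.faces.Finite
  pure : ∀ s ∈ 𝒯.faces, ∃ K ∈ elements 𝒯, s ⊆ K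
  closure_eq : closure Ω = ⋃ K ∈ elements 𝒯, convexHull ℝ (K : Set (Space d))
  interior_subset : ∀ K ∈ elements 𝒯, interior (convexHull ℝ (K : Set (Space d))) ⊆ Ω

/-- The diameter `h_K` of an element. -/
def elementDiam {d : ℕ} (K : Finset (Space d)) : ℝ :=
  Metric.diam (convexHull ℝ (K : Set (Space d)))

/-- Shape regularity with parameter `σ`: every element `K` contains a ball of diameter `h_K / σ`. -/
def IsShapeRegular {d : ℕ} (σ : ℝ) (𝒯 : Geometry.SimplicialComplex ℝ (Space d)) : Prop :=
  ∀ K ∈ elements 𝒯, ∃ x : Space d,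
    Metric.closedBall x (elementDiam K / (2 * σ)) ⊆ convexHull ℝ (K : Set (Space d))

/-- `h_min`, the minimum of the diameters of the elements. -/
def hMin {d : ℕ} (𝒯 : Geometry.SimplicialComplex ℝ (Space d)) : ℝ :=
  sInf (elementDiam '' elements 𝒯)

/-- The functions `v ∈ H¹₀(Ω)` whose restriction to every element is a polynomial of total degree at
most `p`. -/
def femSpace {d : ℕ} (Ω : Set (Space d)) (𝒯 : Geometry.SimplicialComplex ℝ (Space d)) (p : ℕ) :
    Submodule ℝ (H10 Ω) where
  carrier := {v | ∀ K ∈ elements 𝒯, ∃ P : MvPolynomial (Fin d) ℝ, P.totalDegree ≤ p ∧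
    ∀ᵐ x ∂(volume.restrict Ω), x ∈ convexHull ℝ (K : Set (Space d)) →
      val v x = MvPolynomial.eval (fun i => x i) P}
  zero_mem' := by
    intro K _
    refine ⟨0, by simp, ?_⟩
    have h0 : val (0 : H10 Ω) = 0 := rfl
    rw [h0]
    filter_upwards [Lp.coeFn_zero ℝ 2 (volume.restrict Ω)] with x hx _
    rw [hx]
    simp
  add_mem' := by
    intro v w hv hw K hK
    obtain ⟨P, hP, hvP⟩ := hv K hK
    obtain ⟨Q, hQ, hwQ⟩ := hw K hK
    refine ⟨P + Q, (MvPolynomial.totalDegree_add P Q).trans (max_le hP hQ), ?_⟩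
    have h0 : val (v + w) = val v + val w := rfl
    rw [h0]
    filter_upwards [Lp.coeFn_add (val v) (val w), hvP, hwQ] with x hx h1 h2 hxK
    rw [hx, Pi.add_apply, h1 hxK, h2 hxK, map_add]
  smul_mem' := by
    intro r v hv K hK
    obtain ⟨P, hP, hvP⟩ := hv K hK
    refine ⟨r • P, (MvPolynomial.totalDegree_smul_le r P).trans hP, ?_⟩
    have h0 : val (r • v) = r • val v := rfl
    rw [h0]
    filter_upwards [Lp.coeFn_smul r (val v), hvP] with x hx h1 hxK
    rw [hx, Pi.smul_apply, h1 hxK, MvPolynomial.smul_eval, smul_eq_mul]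

/-! ### Time meshes and the discontinuous discrete space -/

/-- A partition `0 = t_0 < t_1 < ⋯ < t_N = T` of the time interval `(0, T)`; the values `node n` with
`n > N` play no role. -/
structure TimeMesh (T : ℝ) where
  /-- The number of time intervals. -/
  N : ℕ
  /-- The nodes `t_n`. -/
  node : ℕ → ℝ
  node_zero : node 0 = 0
  node_last : node N = T
  node_lt : ∀ n < N, node n < node (n + 1)

/-- The maximum time step `τ`. -/
def TimeMesh.maxStep {T : ℝ} (t : TimeMesh T) : ℝ :=
  ⨆ n : Fin t.N, (t.node (n + 1) - t.node n)

/-- `u` belongs to the discontinuous-in-time discrete space: on each open interval `(t_n, t_{n+1})` it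
is a polynomial in time of degree at most `q` with coefficients in the finite element space. The values
of `u` at the nodes and outside `(0, T)` are irrelevant. -/
def MemDG {d : ℕ} {Ω : Set (Space d)} (𝒯 : Geometry.SimplicialComplex ℝ (Space d)) (p q : ℕ) {T : ℝ}
    (t : TimeMesh T) (u : ℝ → H10 Ω) : Prop :=
  ∀ n < t.N, ∃ a : ℕ → H10 Ω, (∀ j, a j ∈ femSpace Ω 𝒯 p) ∧
    ∀ s ∈ Ioo (t.node n) (t.node (n + 1)), u s = ∑ j ∈ Finset.range (q + 1), s ^ j • a j

/-- The time jump `v(s⁺) - v(s⁻)`. -/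
def jump {V : Type*} [AddCommGroup V] [TopologicalSpace V] (v : ℝ → V) (s : ℝ) : V :=
  Function.rightLim v s - Function.leftLim v s

/-- The square of the jump seminorm
`‖v(T⁻)‖² + ∑_{n=1}^{N-1} ‖v(t_n⁺) - v(t_n⁻)‖² + ‖v(0⁺)‖²`. -/
def jumpSeminormSq {V : Type*} [NormedAddCommGroup V] {T : ℝ} (t : TimeMesh T) (v : ℝ → V) : ℝ :=
  ‖Function.leftLim v T‖ ^ 2 + ∑ n ∈ Finset.Ico 1 t.N, ‖jump v (t.node n)‖ ^ 2 +
    ‖Function.rightLim v 0‖ ^ 2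

/-- The norm of `L^∞(0, T; V)`. -/
def supNorm {V : Type*} [NormedAddCommGroup V] (T : ℝ) (v : ℝ → V) : ℝ :=
  (eLpNorm v ∞ (volume.restrict (Ioo 0 T))).toReal

/-- The broken time derivative `∂_τ u`, as a function with values in `L²(Ω)`. -/
def dtVal {d : ℕ} {Ω : Set (Space d)} (u : ℝ → H10 Ω) (s : ℝ) : L2 Ω := val (deriv u s)

/-- The gradient `∇u`, as a function of time with values in `L²(Ω)^d`. -/
def gradCurve {d : ℕ} {Ω : Set (Space d)} (u : ℝ → H10 Ω) (s : ℝ) : L2Vec Ω := grad (u s)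

/-! ### The scheme -/

/-- The bilinear form of the scheme. -/
def bilinForm {d : ℕ} {Ω : Set (Space d)} (c : ℝ) {T : ℝ} (t : TimeMesh T) (u w : ℝ → H10 Ω) : ℝ :=
  (∑ n ∈ Finset.range t.N, ∫ s in (t.node n)..(t.node (n + 1)),
      inner ℝ (val (deriv (deriv u) s)) (val (deriv w s)))
  + (∑ n ∈ Finset.Ico 1 t.N,
      inner ℝ (jump (dtVal u) (t.node n)) (Function.rightLim (dtVal w) (t.node n)))
  + inner ℝ (Function.rightLim (dtVal u) 0) (Function.rightLim (dtVal w) 0)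
  + c ^ 2 * (∑ n ∈ Finset.range t.N, ∫ s in (t.node n)..(t.node (n + 1)),
      inner ℝ (grad (u s)) (grad (deriv w s)))
  + c ^ 2 * (∑ n ∈ Finset.Ico 1 t.N,
      inner ℝ (jump (gradCurve u) (t.node n)) (Function.rightLim (gradCurve w) (t.node n)))
  + c ^ 2 * inner ℝ (Function.rightLim (gradCurve u) 0) (Function.rightLim (gradCurve w) 0)

/-- The linear functional of the scheme. -/
def linForm {d : ℕ} {Ω : Set (Space d)} (c : ℝ) {T : ℝ} (t : TimeMesh T)
    (f : ℝ → L2 Ω) (u₀ : H10 Ω) (v₀ : L2 Ω) (w : ℝ → H10 Ω) : ℝ :=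
  (∑ n ∈ Finset.range t.N, ∫ s in (t.node n)..(t.node (n + 1)),
      inner ℝ (f s) (val (deriv w s)))
  + inner ℝ v₀ (Function.rightLim (dtVal w) 0)
  + c ^ 2 * inner ℝ (grad u₀) (Function.rightLim (gradCurve w) 0)

/-- `u` is a solution of the discrete scheme. -/
def IsDiscreteSolution {d : ℕ} {Ω : Set (Space d)} (𝒯 : Geometry.SimplicialComplex ℝ (Space d))
    (p q : ℕ) (c : ℝ) {T : ℝ} (t : TimeMesh T)
    (f : ℝ → L2 Ω) (u₀ : H10 Ω) (v₀ : L2 Ω) (u : ℝ → H10 Ω) : Prop :=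
  MemDG 𝒯 p q t u ∧
    ∀ w : ℝ → H10 Ω, MemDG 𝒯 p q t w → bilinForm c t u w = linForm c t f u₀ v₀ w

end DGWave

end

/-!
# Stability and unique solvability of a discontinuous Galerkin scheme for the wave equation

Testing with functions that vanish outside one time interval decouples the scheme
(`HasPieces.isDiscreteSolution_iff`) into successive problems on the intervals `(a, b)`, each driven by
the time derivative `U₀` and the gradient `G₀` that come from the preceding interval. Write `A` for the
embedding of the finite element space in `L²`, `B` for the gradient, and `p` for the polynomial in time
that solves such a problem. Three choices of test function carry the proof.

* The test function `p` gives the energy identity `local_energy`: the energy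
  `‖A p'‖² + c² ‖B p‖²` at `b` plus the squared jumps at `a` equals the incoming energy plus
  `2 ∫ (f, A p')`. To estimate the source term, a bound on `A p'` inside the interval is needed.
* Constants in time show that `B p(a)` is a projection of `G₀`. With the inverse estimate
  `‖B v‖ ≤ κ ‖A v‖`, this bounds `c B p` on the whole interval by `c ‖G₀‖` plus a multiple of
  `sup ‖A p'‖`, the factor being the Courant number `c (b - a) κ` (`local_grad_le`).
* Evaluation at a point of `[a, b]` is represented by the form `(φ, ζ) ↦ ∫ φ' ζ + φ(a) ζ(a)` on
  scalar polynomials, with `ζ` bounded in terms of the degree alone (`exists_evalBound`). Testing with an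
  antiderivative of `ζ` times the value of `p'` at a point where `‖A p'‖` is largest bounds
  `sup ‖A p'‖` by the data; the gradient enters with the Courant number as a factor, and the step size
  condition allows it to be absorbed (`local_deriv_le`).

Summing the energy identities, the largest energy of all nodes absorbs the source term
(`energy_bound`), with constants that depend on the degree in time only. One time step is a square linear
system on which the same bounds give uniqueness, hence existence (`local_exists`), and marching through
the intervals gives the unique discrete solution.

The inverse estimate (`exists_inverse_estimate`) needs no reference simplex: an element of diameter `h`
contains a ball of radius `h / (2 σ)` and is contained in the concentric ball of radius `h`, and on
polynomials of bounded degree the `L²` norms on the two balls are comparable by finite dimensionality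
and scaling. On the interior of an element the weak gradient is the gradient of the polynomial
(`grad_ae_eq_gradient`), and distinct elements overlap in a null set. That a function in `H¹₀(Ω)` is
determined by its values, and by its gradient, is `eq_zero_of_val_eq_zero` and the Poincaré inequality
`norm_val_le`.
-/

namespace DGWave

/-! ### The discontinuous Galerkin form for scalar polynomials in time -/

lemma exists_poly_antideriv (ζ : Polynomial ℝ) (k : ℕ) (hζ : ζ.natDegree < k) (a : ℝ) :
    ∃ W : Polynomial ℝ, W.natDegree < k + 1 ∧ W.derivative = ζ ∧ W.eval a = 0 := by
  set W₀ : Polynomial ℝ :=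
    ∑ i ∈ Finset.range k, Polynomial.monomial (i + 1) (ζ.coeff i / ((i : ℝ) + 1)) with hW₀
  have hd : W₀.derivative = ζ := by
    rw [hW₀, Polynomial.derivative_sum]
    conv_rhs => rw [Polynomial.as_sum_range' ζ k hζ]
    refine Finset.sum_congr rfl fun i _ => ?_
    have : (i : ℝ) + 1 ≠ 0 := by positivity
    rw [Polynomial.derivative_monomial]
    simp [div_mul_cancel₀ _ this]
  refine ⟨W₀ - Polynomial.C (W₀.eval a), ?_, by simp [hd], by simp⟩
  rw [Polynomial.natDegree_sub_C, Nat.lt_succ_iff]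
  refine Polynomial.natDegree_sum_le_of_forall_le _ _ fun i hi => ?_
  exact (Polynomial.natDegree_monomial_le _).trans (Finset.mem_range.1 hi)

/-- The discontinuous Galerkin bilinear form of `d/dt` on the reference interval `(0, 1)`,
`(φ, ζ) ↦ ∫₀¹ φ' ζ + φ(0) ζ(0)`. -/
noncomputable def dgForm : Polynomial ℝ →ₗ[ℝ] Polynomial ℝ →ₗ[ℝ] ℝ :=
  LinearMap.mk₂ ℝ
    (fun φ ζ => (∫ x in (0 : ℝ)..1, φ.derivative.eval x * ζ.eval x) + φ.eval 0 * ζ.eval 0)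
    (by
      intro φ₁ φ₂ ζ
      simp only [Polynomial.derivative_add, Polynomial.eval_add, add_mul]
      rw [intervalIntegral.integral_add]
      · ring
      all_goals exact Continuous.intervalIntegrable (by fun_prop) _ _)
    (by
      intro r φ ζ
      simp only [Polynomial.derivative_smul, Polynomial.eval_smul, smul_eq_mul, mul_assoc]
      rw [intervalIntegral.integral_const_mul]
      ring)
    (by
      intro φ ζ₁ ζ₂
      simp only [Polynomial.eval_add, mul_add]
      rw [intervalIntegral.integral_add]
      · ring
      all_goals exact Continuous.intervalIntegrable (by fun_prop) _ _)
    (by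
      intro r φ ζ
      simp only [Polynomial.eval_smul, smul_eq_mul, mul_left_comm _ r]
      rw [intervalIntegral.integral_const_mul]
      ring)

lemma dgForm_apply (φ ζ : Polynomial ℝ) :
    dgForm φ ζ = (∫ x in (0 : ℝ)..1, φ.derivative.eval x * ζ.eval x) + φ.eval 0 * ζ.eval 0 := rfl

lemma dgForm_eq_sub (φ ζ : Polynomial ℝ) :
    dgForm φ ζ = φ.eval 1 * ζ.eval 1 - ∫ x in (0 : ℝ)..1, φ.eval x * ζ.derivative.eval x := by
  have h := intervalIntegral.integral_deriv_mul_eq_sub (a := (0 : ℝ)) (b := 1)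
    (u := fun x => φ.eval x) (v := fun x => ζ.eval x)
    (u' := fun x => φ.derivative.eval x) (v' := fun x => ζ.derivative.eval x)
    (fun x _ => φ.hasDerivAt x) (fun x _ => ζ.hasDerivAt x)
    (Continuous.intervalIntegrable (by fun_prop) _ _)
    (Continuous.intervalIntegrable (by fun_prop) _ _)
  rw [intervalIntegral.integral_add (Continuous.intervalIntegrable (by fun_prop) _ _)
    (Continuous.intervalIntegrable (by fun_prop) _ _)] at h
  rw [dgForm_apply]
  linarith

/-- The form `dgForm` is nondegenerate on polynomials of degree less than `k`: testing with `ζ`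
itself gives `ζ(0) = ζ(1) = 0`, and then testing with `ζ'` gives `ζ' = 0`. -/
lemma eq_zero_of_dgForm_eq_zero {k : ℕ} {ζ : Polynomial ℝ} (hζ : ζ ∈ Polynomial.degreeLT ℝ k)
    (h : ∀ φ ∈ Polynomial.degreeLT ℝ k, dgForm φ ζ = 0) : ζ = 0 := by
  have h1 := h ζ hζ
  have h2 := h1
  rw [dgForm_apply] at h1
  rw [dgForm_eq_sub] at h2
  have hI : (∫ x in (0 : ℝ)..1, ζ.eval x * ζ.derivative.eval x)
      = ∫ x in (0 : ℝ)..1, ζ.derivative.eval x * ζ.eval x := by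
    simp only [mul_comm]
  rw [hI] at h2
  have h0 : ζ.eval 0 = 0 := by nlinarith [sq_nonneg (ζ.eval 0), sq_nonneg (ζ.eval 1)]
  have h1' : ζ.eval 1 = 0 := by nlinarith [sq_nonneg (ζ.eval 0), sq_nonneg (ζ.eval 1)]
  have hd : ζ.derivative ∈ Polynomial.degreeLT ℝ k := by
    rw [Polynomial.mem_degreeLT] at hζ ⊢
    exact (Polynomial.degree_derivative_le).trans_lt hζ
  have h3 := h _ hd
  rw [dgForm_eq_sub, h1', mul_zero, zero_sub, neg_eq_zero] at h3
  have hz : ∀ x ∈ Ioc (0 : ℝ) 1, ζ.derivative.eval x = 0 := by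
    have hc : ContinuousOn (fun x => ζ.derivative.eval x * ζ.derivative.eval x) (Icc (0 : ℝ) 1) :=
      Continuous.continuousOn (by fun_prop)
    intro x hx
    by_contra hne
    have := intervalIntegral.integral_pos (zero_lt_one) hc
      (fun x _ => mul_self_nonneg _) ⟨x, ⟨hx.1.le, hx.2⟩, mul_self_pos.2 hne⟩
    linarith
  have hder : ζ.derivative = 0 := by
    refine Polynomial.eq_zero_of_infinite_isRoot _ (Set.Infinite.mono ?_ (Ioc_infinite zero_lt_one))
    exact fun x hx => hz x hx
  rw [Polynomial.eq_C_of_derivative_eq_zero hder] at h0 ⊢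
  simpa using h0

/-- Every linear functional on polynomials of degree less than `k` is represented through `dgForm`. -/
lemma exists_dgForm_eq (k : ℕ) (ℓ : Module.Dual ℝ (Polynomial ℝ)) :
    ∃ ζ ∈ Polynomial.degreeLT ℝ k, ∀ φ ∈ Polynomial.degreeLT ℝ k, dgForm φ ζ = ℓ φ := by
  have : FiniteDimensional ℝ (Polynomial.degreeLT ℝ k) :=
    LinearEquiv.finiteDimensional (Polynomial.degreeLTEquiv ℝ k).symm
  let L : Polynomial.degreeLT ℝ k →ₗ[ℝ] Module.Dual ℝ (Polynomial.degreeLT ℝ k) :=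
    (dgForm.flip.compl₁₂ (Polynomial.degreeLT ℝ k).subtype (Polynomial.degreeLT ℝ k).subtype)
  have hL : ∀ ζ φ, L ζ φ = dgForm φ ζ := fun ζ φ => rfl
  have hinj : Function.Injective L := by
    rw [← LinearMap.ker_eq_bot, LinearMap.ker_eq_bot']
    intro ζ hζ
    refine Subtype.ext (eq_zero_of_dgForm_eq_zero ζ.2 fun φ hφ => ?_)
    have := LinearMap.congr_fun hζ ⟨φ, hφ⟩
    simpa [hL] using this
  have hsurj : Function.Surjective L :=
    (LinearMap.injective_iff_surjective_of_finrank_eq_finrank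
      Subspace.dual_finrank_eq.symm).1 hinj
  obtain ⟨ζ, hζ⟩ := hsurj (ℓ.comp (Polynomial.degreeLT ℝ k).subtype)
  refine ⟨ζ, ζ.2, fun φ hφ => ?_⟩
  have := LinearMap.congr_fun hζ ⟨φ, hφ⟩
  simpa [hL] using this

lemma mem_degreeLT_succ_iff {k : ℕ} {φ : Polynomial ℝ} :
    φ ∈ Polynomial.degreeLT ℝ (k + 1) ↔ φ.natDegree < k + 1 := by
  rw [Polynomial.degreeLT_succ_eq_degreeLE, Polynomial.mem_degreeLE,
    ← Polynomial.natDegree_le_iff_degree_le, Nat.lt_succ_iff]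

/-- Point evaluation on `[0, 1]` is represented through `dgForm` by polynomials that are bounded
uniformly in the evaluation point. -/
lemma exists_dgForm_eval_unit (k : ℕ) : ∃ K : ℝ, 0 < K ∧ ∀ s ∈ Icc (0 : ℝ) 1,
    ∃ ζ : Polynomial ℝ, ζ ∈ Polynomial.degreeLT ℝ (k + 1) ∧ (∀ x ∈ Icc (0 : ℝ) 1, |ζ.eval x| ≤ K) ∧
      ∀ φ ∈ Polynomial.degreeLT ℝ (k + 1), dgForm φ ζ = φ.eval s := by
  choose ζ hζ hζφ using fun j : ℕ => exists_dgForm_eq (k + 1) (Polynomial.lcoeff ℝ j)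
  have hb : ∀ j, ∃ K : ℝ, ∀ x ∈ Icc (0 : ℝ) 1, ‖(ζ j).eval x‖ ≤ K := fun j =>
    isCompact_Icc.exists_bound_of_continuousOn (ζ j).continuousOn
  choose K hK using hb
  have hK0 : ∀ j, 0 ≤ K j := fun j => (norm_nonneg _).trans (hK j 0 (by simp))
  refine ⟨∑ j ∈ Finset.range (k + 1), K j + 1,
    by have := Finset.sum_nonneg fun j (_ : j ∈ Finset.range (k + 1)) => hK0 j; linarith, ?_⟩
  intro s hs
  refine ⟨∑ j ∈ Finset.range (k + 1), s ^ j • ζ j,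
    Submodule.sum_mem _ fun j _ => Submodule.smul_mem _ _ (hζ j), ?_, ?_⟩
  · intro x hx
    rw [Polynomial.eval_finsetSum]
    refine (Finset.abs_sum_le_sum_abs _ _).trans ((Finset.sum_le_sum fun j _ => ?_).trans
      (le_add_of_nonneg_right zero_le_one))
    rw [Polynomial.eval_smul, smul_eq_mul, abs_mul, abs_of_nonneg (pow_nonneg hs.1 j)]
    calc s ^ j * |(ζ j).eval x| ≤ 1 * |(ζ j).eval x| := by
          gcongr
          exact pow_le_one₀ hs.1 hs.2
      _ ≤ K j := by rw [one_mul]; exact hK j x hx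
  · intro φ hφ
    rw [map_sum]
    rw [Polynomial.eval_eq_sum_range' (n := k + 1)]
    · refine Finset.sum_congr rfl fun j _ => ?_
      rw [map_smul, hζφ j φ hφ, Polynomial.lcoeff_apply, smul_eq_mul, mul_comm]
    · exact mem_degreeLT_succ_iff.1 hφ

/-- On every interval `[a, b]`, evaluation of polynomials of degree at most `k` at a point of the
interval is represented by the discontinuous Galerkin form through a polynomial bounded by `K`. -/
def EvalBound (k : ℕ) (K : ℝ) : Prop :=
  ∀ a b : ℝ, a < b → ∀ s ∈ Icc a b,
    ∃ ζ : Polynomial ℝ, ζ.natDegree < k + 1 ∧ (∀ x ∈ Icc a b, |ζ.eval x| ≤ K) ∧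
      ∀ φ : Polynomial ℝ, φ.natDegree < k + 1 →
        (∫ x in a..b, φ.derivative.eval x * ζ.eval x) + φ.eval a * ζ.eval a = φ.eval s

/-- The constant in `EvalBound` depends on the degree only: an affine change of variables reduces
every interval to the reference interval. -/
lemma exists_evalBound (k : ℕ) : ∃ K : ℝ, 0 < K ∧ EvalBound k K := by
  obtain ⟨K, hK0, hK⟩ := exists_dgForm_eval_unit k
  have hdeg : ∀ φ : Polynomial ℝ, φ ∈ Polynomial.degreeLT ℝ (k + 1) ↔ φ.natDegree < k + 1 :=
    fun φ => mem_degreeLT_succ_iff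
  refine ⟨K, hK0, fun a b hab s hs => ?_⟩
  have hτ : 0 < b - a := sub_pos.2 hab
  obtain ⟨ζ, hζd, hζK, hζ⟩ := hK ((s - a) / (b - a))
    ⟨div_nonneg (sub_nonneg.2 hs.1) hτ.le, (div_le_one hτ).2 (by linarith [hs.2])⟩
  refine ⟨ζ.comp (Polynomial.C (b - a)⁻¹ * (Polynomial.X - Polynomial.C a)), ?_, ?_, ?_⟩
  · refine lt_of_le_of_lt ?_ ((hdeg ζ).1 hζd)
    refine Polynomial.natDegree_comp_le.trans ?_
    have : (Polynomial.C (b - a)⁻¹ * (Polynomial.X - Polynomial.C a)).natDegree ≤ 1 := by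
      refine (Polynomial.natDegree_C_mul_le _ _).trans ?_
      rw [Polynomial.natDegree_X_sub_C]
    nlinarith
  · intro x hx
    simp only [Polynomial.eval_comp, Polynomial.eval_mul, Polynomial.eval_C, Polynomial.eval_sub,
      Polynomial.eval_X]
    refine hζK _ ⟨mul_nonneg (inv_nonneg.2 hτ.le) (sub_nonneg.2 hx.1), ?_⟩
    rw [inv_mul_le_one₀ hτ]
    linarith [hx.2]
  · intro φ hφ
    have h := hζ (φ.comp (Polynomial.C a + Polynomial.C (b - a) * Polynomial.X)) (by
      rw [hdeg]
      refine lt_of_le_of_lt ?_ hφ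
      refine Polynomial.natDegree_comp_le.trans ?_
      have : (Polynomial.C a + Polynomial.C (b - a) * Polynomial.X).natDegree ≤ 1 := by
        rw [add_comm]
        exact Polynomial.natDegree_linear_le
      nlinarith)
    rw [dgForm_apply] at h
    simp only [Polynomial.eval_comp, Polynomial.eval_mul, Polynomial.eval_C, Polynomial.eval_sub,
      Polynomial.eval_X, Polynomial.eval_add, Polynomial.derivative_comp,
      Polynomial.derivative_add, Polynomial.derivative_C, Polynomial.derivative_mul,
      Polynomial.derivative_X, zero_mul, mul_one, zero_add, mul_zero, add_zero] at h ⊢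
    rw [sub_self, mul_zero]
    have hs' : a + (b - a) * ((s - a) / (b - a)) = s := by
      rw [mul_div_cancel₀ _ hτ.ne']; ring
    rw [hs'] at h
    rw [← h]
    congr 1
    have hsub := intervalIntegral.smul_integral_comp_add_mul (a := (0 : ℝ)) (b := 1)
      (fun x => φ.derivative.eval x * ζ.eval ((b - a)⁻¹ * (x - a))) (b - a) a
    rw [mul_zero, add_zero, mul_one, add_sub_cancel] at hsub
    rw [← hsub, smul_eq_mul, ← intervalIntegral.integral_const_mul]
    refine intervalIntegral.integral_congr fun x _ => ?_
    simp only [add_sub_cancel_left, inv_mul_cancel_left₀ hτ.ne']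
    ring

/-! ### Polynomial curves in a vector space -/

section PolyCurve

variable {E : Type*} [NormedAddCommGroup E] [NormedSpace ℝ E]

/-- The polynomial curve `s ↦ ∑_{j < m} s ^ j a_j`. -/
def polyCurve (m : ℕ) (a : ℕ → E) (s : ℝ) : E := ∑ j ∈ Finset.range m, s ^ j • a j

/-- The coefficients of the derivative of a polynomial curve. -/
def diffCoeff (a : ℕ → E) (j : ℕ) : E := ((j : ℝ) + 1) • a (j + 1)

lemma hasDerivAt_polyCurve (m : ℕ) (a : ℕ → E) (s : ℝ) :
    HasDerivAt (polyCurve (m + 1) a) (polyCurve m (diffCoeff a) s) s := by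
  have h : ∀ j ∈ Finset.range (m + 1),
      HasDerivAt (fun x : ℝ => x ^ j • a j) (((j : ℝ) * s ^ (j - 1)) • a j) s :=
    fun j _ => (hasDerivAt_pow j s).smul_const (a j)
  have h2 := HasDerivAt.fun_sum h
  rw [Finset.sum_range_succ'] at h2
  refine h2.congr_deriv ?_
  simp [polyCurve, diffCoeff, smul_smul, mul_comm]

@[fun_prop]
lemma continuous_polyCurve (m : ℕ) (a : ℕ → E) : Continuous (polyCurve m a) := by
  unfold polyCurve
  fun_prop

lemma polyCurve_mem {S : Submodule ℝ E} {a : ℕ → E} (ha : ∀ j, a j ∈ S) (m : ℕ) (s : ℝ) :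
    polyCurve m a s ∈ S :=
  S.sum_mem fun j _ => S.smul_mem _ (ha j)

lemma diffCoeff_mem {S : Submodule ℝ E} {a : ℕ → E} (ha : ∀ j, a j ∈ S) (j : ℕ) :
    diffCoeff a j ∈ S :=
  S.smul_mem _ (ha _)

lemma polyCurve_add (m : ℕ) (a b : ℕ → E) (s : ℝ) :
    polyCurve m (a + b) s = polyCurve m a s + polyCurve m b s := by
  simp [polyCurve, Finset.sum_add_distrib]

lemma polyCurve_smul (m : ℕ) (r : ℝ) (a : ℕ → E) (s : ℝ) :
    polyCurve m (r • a) s = r • polyCurve m a s := by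
  simp only [polyCurve, Pi.smul_apply, Finset.smul_sum]
  exact Finset.sum_congr rfl fun j _ => smul_comm _ _ _

lemma polyCurve_zero (m : ℕ) (s : ℝ) : polyCurve m (0 : ℕ → E) s = 0 := by
  simp [polyCurve]

lemma diffCoeff_add (a b : ℕ → E) : diffCoeff (a + b) = diffCoeff a + diffCoeff b := by
  ext j; simp [diffCoeff]

lemma diffCoeff_smul (r : ℝ) (a : ℕ → E) : diffCoeff (r • a) = r • diffCoeff a := by
  ext j; simp only [diffCoeff, Pi.smul_apply]; exact smul_comm _ _ _

lemma diffCoeff_zero : diffCoeff (0 : ℕ → E) = 0 := by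
  ext j; simp [diffCoeff]

lemma polyCurve_congr {m : ℕ} {a b : ℕ → E} (h : ∀ j < m, a j = b j) (s : ℝ) :
    polyCurve m a s = polyCurve m b s :=
  Finset.sum_congr rfl fun j hj => by rw [h j (Finset.mem_range.1 hj)]

lemma polyCurve_coeff_smul {m : ℕ} {W : Polynomial ℝ} (hW : W.natDegree < m) (h : E) (s : ℝ) :
    polyCurve m (fun j => W.coeff j • h) s = W.eval s • h := by
  rw [Polynomial.eval_eq_sum_range' hW, Finset.sum_smul]
  exact Finset.sum_congr rfl fun j _ => by rw [smul_smul, mul_comm]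

lemma diffCoeff_coeff_smul (W : Polynomial ℝ) (h : E) :
    diffCoeff (fun j => W.coeff j • h) = fun j => W.derivative.coeff j • h := by
  ext j
  rw [diffCoeff, Polynomial.coeff_derivative, smul_smul, mul_comm]

/-- A linear functional of a polynomial curve is a scalar polynomial. -/
lemma exists_poly_eval_eq (m : ℕ) (a : ℕ → E) (ℓ : E →ₗ[ℝ] ℝ) :
    ∃ φ : Polynomial ℝ, φ.natDegree < m + 1 ∧ (∀ j < m + 1, φ.coeff j = ℓ (a j)) ∧
      ∀ s, φ.eval s = ℓ (polyCurve (m + 1) a s) := by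
  refine ⟨∑ j ∈ Finset.range (m + 1), Polynomial.monomial j (ℓ (a j)), ?_, ?_, ?_⟩
  · rw [Nat.lt_succ_iff]
    refine Polynomial.natDegree_sum_le_of_forall_le _ _ fun j hj => ?_
    exact (Polynomial.natDegree_monomial_le _).trans (Nat.lt_succ_iff.1 (Finset.mem_range.1 hj))
  · intro j hj
    rw [Polynomial.finsetSum_coeff]
    simp [Polynomial.coeff_monomial, Nat.lt_succ_iff.1 hj]
  · intro s
    simp [Polynomial.eval_finsetSum, polyCurve, mul_comm]

lemma coeff_eq_zero_of_polyCurve_eq_zero {m : ℕ} {α : ℕ → E} {a b : ℝ} (hab : a < b)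
    (h : ∀ s ∈ Icc a b, polyCurve (m + 1) α s = 0) : ∀ j < m + 1, α j = 0 := by
  intro j hj
  rw [← Module.forall_dual_apply_eq_zero_iff ℝ]
  intro ℓ
  obtain ⟨φ, -, hφc, hφ⟩ := exists_poly_eval_eq m α ℓ
  have : φ = 0 := by
    refine Polynomial.eq_zero_of_infinite_isRoot _ (Set.Infinite.mono ?_ (Icc_infinite hab))
    intro s hs
    change φ.eval s = 0
    rw [hφ, h s hs, map_zero]
  rw [← hφc j hj, this, Polynomial.coeff_zero]

lemma coeff_eq_of_polyCurve_eq {m : ℕ} {α α' : ℕ → E} {a b : ℝ} (hab : a < b)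
    (h : ∀ s ∈ Icc a b, polyCurve (m + 1) α s = polyCurve (m + 1) α' s) :
    ∀ j < m + 1, α j = α' j := by
  intro j hj
  have h1 := coeff_eq_zero_of_polyCurve_eq_zero (α := α + (-1 : ℝ) • α') hab (fun s hs => by
    rw [polyCurve_add, polyCurve_smul, h s hs, neg_one_smul, add_neg_cancel]) j hj
  rw [Pi.add_apply, Pi.smul_apply, neg_one_smul, ← sub_eq_add_neg] at h1
  exact sub_eq_zero.1 h1

end PolyCurve

/-! ### The problem on one time interval -/

section Local

variable {E X Y : Type*} [NormedAddCommGroup E] [NormedSpace ℝ E]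
  [NormedAddCommGroup X] [InnerProductSpace ℝ X] [NormedAddCommGroup Y] [InnerProductSpace ℝ Y]

/-- The bilinear form of one time step on `(a, b)`, in terms of the coefficients of polynomial curves
of degree at most `m + 1`; the data from the preceding interval are not part of it. The maps `A` and
`B` stand for the embedding in `L²` and for the gradient. -/
noncomputable def localForm (A : E →L[ℝ] X) (B : E →L[ℝ] Y) (c : ℝ) (m : ℕ) (a b : ℝ) :
    (ℕ → E) →ₗ[ℝ] (ℕ → E) →ₗ[ℝ] ℝ :=
  LinearMap.mk₂ ℝ
    (fun α β =>
      (∫ s in a..b, inner ℝ (A (polyCurve m (diffCoeff (diffCoeff α)) s))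
        (A (polyCurve (m + 1) (diffCoeff β) s)))
      + inner ℝ (A (polyCurve (m + 1) (diffCoeff α) a)) (A (polyCurve (m + 1) (diffCoeff β) a))
      + c ^ 2 * (∫ s in a..b, inner ℝ (B (polyCurve (m + 2) α s))
          (B (polyCurve (m + 1) (diffCoeff β) s)))
      + c ^ 2 * inner ℝ (B (polyCurve (m + 2) α a)) (B (polyCurve (m + 2) β a)))
    (by
      intro α₁ α₂ β
      simp only [diffCoeff_add, polyCurve_add, map_add, inner_add_left]
      rw [intervalIntegral.integral_add, intervalIntegral.integral_add]
      · ring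
      all_goals exact Continuous.intervalIntegrable (by fun_prop) _ _)
    (by
      intro r α β
      simp only [diffCoeff_smul, polyCurve_smul, map_smul, inner_smul_left, RCLike.conj_to_real]
      rw [intervalIntegral.integral_const_mul, intervalIntegral.integral_const_mul, smul_eq_mul]
      ring)
    (by
      intro α β₁ β₂
      simp only [diffCoeff_add, polyCurve_add, map_add, inner_add_right]
      rw [intervalIntegral.integral_add, intervalIntegral.integral_add]
      · ring
      all_goals exact Continuous.intervalIntegrable (by fun_prop) _ _)
    (by
      intro r α β
      simp only [diffCoeff_smul, polyCurve_smul, map_smul, inner_smul_right]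
      rw [intervalIntegral.integral_const_mul, intervalIntegral.integral_const_mul, smul_eq_mul]
      ring)

lemma localForm_apply (A : E →L[ℝ] X) (B : E →L[ℝ] Y) (c : ℝ) (m : ℕ) (a b : ℝ) (α β : ℕ → E) :
    localForm A B c m a b α β =
      (∫ s in a..b, inner ℝ (A (polyCurve m (diffCoeff (diffCoeff α)) s))
        (A (polyCurve (m + 1) (diffCoeff β) s)))
      + inner ℝ (A (polyCurve (m + 1) (diffCoeff α) a)) (A (polyCurve (m + 1) (diffCoeff β) a))
      + c ^ 2 * (∫ s in a..b, inner ℝ (B (polyCurve (m + 2) α s))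
          (B (polyCurve (m + 1) (diffCoeff β) s)))
      + c ^ 2 * inner ℝ (B (polyCurve (m + 2) α a)) (B (polyCurve (m + 2) β a)) := rfl

/-- The right-hand side of one time step with source `f` and with data `U₀`, `G₀` (the time
derivative and the gradient) from the preceding interval. -/
noncomputable def localLoad (A : E →L[ℝ] X) (B : E →L[ℝ] Y) (c : ℝ) (m : ℕ) (a b : ℝ)
    (f : ℝ → X) (U₀ : X) (G₀ : Y) (β : ℕ → E) : ℝ :=
  (∫ s in a..b, inner ℝ (f s) (A (polyCurve (m + 1) (diffCoeff β) s)))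
  + inner ℝ U₀ (A (polyCurve (m + 1) (diffCoeff β) a))
  + c ^ 2 * inner ℝ G₀ (B (polyCurve (m + 2) β a))

lemma localForm_sub_localLoad (A : E →L[ℝ] X) (B : E →L[ℝ] Y) (c : ℝ) (m : ℕ) (a b : ℝ)
    (f : ℝ → X) (U₀ : X) (G₀ : Y) (α β : ℕ → E) :
    localForm A B c m a b α β - localLoad A B c m a b f U₀ G₀ β =
      (∫ s in a..b, inner ℝ (A (polyCurve m (diffCoeff (diffCoeff α)) s))
        (A (polyCurve (m + 1) (diffCoeff β) s)))
      + inner ℝ (A (polyCurve (m + 1) (diffCoeff α) a) - U₀)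
        (A (polyCurve (m + 1) (diffCoeff β) a))
      + c ^ 2 * (∫ s in a..b, inner ℝ (B (polyCurve (m + 2) α s))
          (B (polyCurve (m + 1) (diffCoeff β) s)))
      + c ^ 2 * inner ℝ (B (polyCurve (m + 2) α a) - G₀) (B (polyCurve (m + 2) β a))
      - ∫ s in a..b, inner ℝ (f s) (A (polyCurve (m + 1) (diffCoeff β) s)) := by
  rw [localForm_apply, localLoad, inner_sub_left, inner_sub_left]
  ring

lemma localLoad_zero (A : E →L[ℝ] X) (B : E →L[ℝ] Y) (c : ℝ) (m : ℕ) (a b : ℝ)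
    (f : ℝ → X) (U₀ : X) (G₀ : Y) : localLoad A B c m a b f U₀ G₀ 0 = 0 := by
  simp [localLoad, diffCoeff_zero, polyCurve_zero]

lemma intervalIntegrable_inner {f g : ℝ → X} {a b : ℝ} (hf : IntervalIntegrable f volume a b)
    (hg : Continuous g) : IntervalIntegrable (fun s => (inner ℝ (f s) (g s) : ℝ)) volume a b := by
  obtain ⟨C, hC⟩ := (isCompact_uIcc (a := a) (b := b)).exists_bound_of_continuousOn hg.continuousOn
  refine (hf.norm.mul_const C).mono_fun ?_ ?_
  · exact hf.def'.aestronglyMeasurable.inner hg.aestronglyMeasurable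
  · filter_upwards [ae_restrict_mem measurableSet_uIoc] with s hs
    refine (norm_inner_le_norm _ _).trans ((mul_le_mul_of_nonneg_left
      (hC s (uIoc_subset_uIcc hs)) (norm_nonneg _)).trans (le_abs_self _))

lemma localLoad_add (A : E →L[ℝ] X) (B : E →L[ℝ] Y) (c : ℝ) (m : ℕ) {a b : ℝ}
    {f : ℝ → X} (hf : IntervalIntegrable f volume a b) (U₀ : X) (G₀ : Y) (β γ : ℕ → E) :
    localLoad A B c m a b f U₀ G₀ (β + γ)
      = localLoad A B c m a b f U₀ G₀ β + localLoad A B c m a b f U₀ G₀ γ := by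
  simp only [localLoad, diffCoeff_add, polyCurve_add, map_add, inner_add_right]
  rw [intervalIntegral.integral_add]
  · ring
  all_goals exact intervalIntegrable_inner hf (by fun_prop)

lemma localLoad_smul (A : E →L[ℝ] X) (B : E →L[ℝ] Y) (c : ℝ) (m : ℕ) (a b : ℝ)
    (f : ℝ → X) (U₀ : X) (G₀ : Y) (r : ℝ) (β : ℕ → E) :
    localLoad A B c m a b f U₀ G₀ (r • β) = r * localLoad A B c m a b f U₀ G₀ β := by
  simp only [localLoad, diffCoeff_smul, polyCurve_smul, map_smul, inner_smul_right]
  rw [intervalIntegral.integral_const_mul]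
  ring

lemma integral_inner_deriv {g g' : ℝ → X} {a b : ℝ} (hg : ∀ s, HasDerivAt g (g' s) s)
    (hc : Continuous g') :
    2 * ∫ s in a..b, (inner ℝ (g s) (g' s) : ℝ) = ‖g b‖ ^ 2 - ‖g a‖ ^ 2 := by
  have hgc : Continuous g := continuous_iff_continuousAt.2 fun s => (hg s).continuousAt
  rw [← intervalIntegral.integral_const_mul]
  exact intervalIntegral.integral_eq_sub_of_hasDerivAt (fun s _ => (hg s).norm_sq)
    (Continuous.intervalIntegrable (by fun_prop) _ _)

/-- The energy identity of one time step, obtained by testing with the solution itself. -/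
lemma local_energy {A : E →L[ℝ] X} {B : E →L[ℝ] Y} {c : ℝ} {m : ℕ} {a b : ℝ}
    {f : ℝ → X} {U₀ : X} {G₀ : Y} {α : ℕ → E}
    (h : localForm A B c m a b α α = localLoad A B c m a b f U₀ G₀ α) :
    ‖A (polyCurve (m + 1) (diffCoeff α) b)‖ ^ 2 + c ^ 2 * ‖B (polyCurve (m + 2) α b)‖ ^ 2
      + (‖A (polyCurve (m + 1) (diffCoeff α) a) - U₀‖ ^ 2
        + c ^ 2 * ‖B (polyCurve (m + 2) α a) - G₀‖ ^ 2)
    = ‖U₀‖ ^ 2 + c ^ 2 * ‖G₀‖ ^ 2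
      + 2 * ∫ s in a..b, inner ℝ (f s) (A (polyCurve (m + 1) (diffCoeff α) s)) := by
  have h1 := integral_inner_deriv (a := a) (b := b)
    (fun s => A.hasFDerivAt.comp_hasDerivAt s (hasDerivAt_polyCurve m (diffCoeff α) s))
    (by fun_prop)
  have h2 := integral_inner_deriv (a := a) (b := b)
    (fun s => B.hasFDerivAt.comp_hasDerivAt s (hasDerivAt_polyCurve (m + 1) α s)) (by fun_prop)
  simp only [Function.comp_apply] at h1 h2
  rw [localForm_apply, localLoad] at h
  simp only [real_inner_self_eq_norm_sq] at h
  simp only [real_inner_comm] at h1 h2 h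
  rw [norm_sub_sq_real, norm_sub_sq_real]
  simp only [real_inner_comm]
  linear_combination 2 * h - h1 - c ^ 2 * h2


lemma local_test_poly {A : E →L[ℝ] X} {B : E →L[ℝ] Y} {c : ℝ} {m : ℕ} {a b : ℝ}
    {f : ℝ → X} {U₀ : X} {G₀ : Y} {α : ℕ → E} {S : Submodule ℝ E}
    (h : ∀ β : ℕ → E, (∀ j, β j ∈ S) →
      localForm A B c m a b α β = localLoad A B c m a b f U₀ G₀ β)
    {W : Polynomial ℝ} (hW : W.natDegree < m + 2) {v : E} (hv : v ∈ S) :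
    (∫ s in a..b, W.derivative.eval s *
        inner ℝ (A (polyCurve m (diffCoeff (diffCoeff α)) s)) (A v))
      + W.derivative.eval a * inner ℝ (A (polyCurve (m + 1) (diffCoeff α) a)) (A v)
      + c ^ 2 * (∫ s in a..b, W.derivative.eval s *
          inner ℝ (B (polyCurve (m + 2) α s)) (B v))
      + c ^ 2 * (W.eval a * inner ℝ (B (polyCurve (m + 2) α a)) (B v))
    = (∫ s in a..b, W.derivative.eval s * inner ℝ (f s) (A v))
      + W.derivative.eval a * inner ℝ U₀ (A v) + c ^ 2 * (W.eval a * inner ℝ G₀ (B v)) := by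
  have hW' : W.derivative.natDegree < m + 1 :=
    lt_of_le_of_lt (Polynomial.natDegree_derivative_le W) (by omega)
  have := h (fun j => W.coeff j • v) (fun j => S.smul_mem _ hv)
  rw [localForm_apply, localLoad] at this
  simp only [diffCoeff_coeff_smul, polyCurve_coeff_smul hW, polyCurve_coeff_smul hW', map_smul,
    inner_smul_right] at this
  exact this

/-- Testing with functions that are constant in time shows that the gradient at the left endpoint is
the projection of the incoming gradient. -/
lemma local_grad_left_le {A : E →L[ℝ] X} {B : E →L[ℝ] Y} {c : ℝ} (hc : 0 < c) {m : ℕ} {a b : ℝ}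
    {f : ℝ → X} {U₀ : X} {G₀ : Y} {α : ℕ → E} {S : Submodule ℝ E} (hα : ∀ j, α j ∈ S)
    (h : ∀ β : ℕ → E, (∀ j, β j ∈ S) →
      localForm A B c m a b α β = localLoad A B c m a b f U₀ G₀ β) :
    ‖B (polyCurve (m + 2) α a)‖ ≤ ‖G₀‖ := by
  have h1 := local_test_poly h (W := 1) (by simp) (polyCurve_mem hα (m + 2) a)
  simp only [Polynomial.derivative_one, Polynomial.eval_zero, zero_mul,
    intervalIntegral.integral_zero, Polynomial.eval_one, one_mul, zero_add, mul_zero, add_zero,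
    real_inner_self_eq_norm_sq] at h1
  have h2 : ‖B (polyCurve (m + 2) α a)‖ ^ 2 ≤ ‖G₀‖ * ‖B (polyCurve (m + 2) α a)‖ := by
    rw [mul_left_cancel₀ (by positivity : c ^ 2 ≠ 0) h1]
    exact real_inner_le_norm _ _
  by_contra hlt
  push Not at hlt
  nlinarith [norm_nonneg G₀]

/-- The gradient on the interval is controlled by the incoming gradient and the time derivative, by
the inverse estimate `‖B v‖ ≤ κ ‖A v‖`. -/
lemma local_grad_le {A : E →L[ℝ] X} {B : E →L[ℝ] Y} {c : ℝ} (hc : 0 < c) {m : ℕ} {a b : ℝ}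
    (hab : a < b) {f : ℝ → X} {U₀ : X} {G₀ : Y} {α : ℕ → E} {S : Submodule ℝ E}
    (hα : ∀ j, α j ∈ S)
    (h : ∀ β : ℕ → E, (∀ j, β j ∈ S) →
      localForm A B c m a b α β = localLoad A B c m a b f U₀ G₀ β)
    {κ : ℝ} (hκ0 : 0 ≤ κ) (hκ : ∀ v ∈ S, ‖B v‖ ≤ κ * ‖A v‖) {M : ℝ}
    (hM : ∀ s ∈ Icc a b, ‖A (polyCurve (m + 1) (diffCoeff α) s)‖ ≤ M) :
    ∀ s ∈ Icc a b, c * ‖B (polyCurve (m + 2) α s)‖ ≤ c * ‖G₀‖ + c * (b - a) * κ * M := by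
  intro s hs
  have hM0 : 0 ≤ M := (norm_nonneg _).trans (hM s hs)
  have h1 : ‖B (polyCurve (m + 2) α s) - B (polyCurve (m + 2) α a)‖ ≤ κ * M * ‖s - a‖ :=
    (convex_Icc a b).norm_image_sub_le_of_norm_hasDerivWithin_le
      (f := fun s => B (polyCurve (m + 2) α s))
      (fun x _ => (B.hasFDerivAt.comp_hasDerivAt x
        (hasDerivAt_polyCurve (m + 1) α x)).hasDerivWithinAt)
      (fun x hx => (hκ _ (polyCurve_mem (diffCoeff_mem hα) _ _)).trans
        (mul_le_mul_of_nonneg_left (hM x hx) hκ0))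
      (left_mem_Icc.2 hab.le) hs
  have h2 := local_grad_left_le hc hα h
  have h3 : ‖s - a‖ ≤ b - a := by
    rw [Real.norm_of_nonneg (sub_nonneg.2 hs.1)]
    linarith [hs.2]
  have h4 : ‖B (polyCurve (m + 2) α s)‖ ≤ ‖G₀‖ + κ * M * (b - a) := by
    have := norm_le_insert' (B (polyCurve (m + 2) α s)) (B (polyCurve (m + 2) α a))
    have := mul_le_mul_of_nonneg_left h3 (mul_nonneg hκ0 hM0)
    linarith
  calc c * ‖B (polyCurve (m + 2) α s)‖ ≤ c * (‖G₀‖ + κ * M * (b - a)) := by gcongr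
    _ = _ := by ring

/-- The time derivative on the interval is controlled by the data. Evaluation at the point where
`‖A p'‖` is largest is represented by the scalar form of `EvalBound`, and the gradient term is a
perturbation that the step size condition makes small. -/
lemma local_deriv_le {A : E →L[ℝ] X} {B : E →L[ℝ] Y} {c : ℝ} (hc : 0 < c) {m : ℕ} {a b : ℝ}
    (hab : a < b) {f : ℝ → X} (hf : IntervalIntegrable f volume a b)
    {U₀ : X} {G₀ : Y} {α : ℕ → E} {S : Submodule ℝ E}
    (hα : ∀ j, α j ∈ S)
    (h : ∀ β : ℕ → E, (∀ j, β j ∈ S) →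
      localForm A B c m a b α β = localLoad A B c m a b f U₀ G₀ β)
    {κ : ℝ} (hκ0 : 0 ≤ κ) (hκ : ∀ v ∈ S, ‖B v‖ ≤ κ * ‖A v‖) {K : ℝ} (hK : EvalBound m K)
    (hε : c * (b - a) * κ ≤ 1) (hKε : K * (c * (b - a) * κ) ≤ 1 / 2) :
    ∀ s ∈ Icc a b, ‖A (polyCurve (m + 1) (diffCoeff α) s)‖
      ≤ 2 * K * (‖U₀‖ + ∫ s in a..b, ‖f s‖) + c * ‖G₀‖ := by
  obtain ⟨s₀, hs₀, hmax⟩ := isCompact_Icc.exists_isMaxOn (nonempty_Icc.2 hab.le)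
    (f := fun s => ‖A (polyCurve (m + 1) (diffCoeff α) s)‖)
    (Continuous.continuousOn (by fun_prop))
  set v : E := polyCurve (m + 1) (diffCoeff α) s₀ with hv
  have hvS : v ∈ S := polyCurve_mem (diffCoeff_mem hα) _ _
  have hM : ∀ s ∈ Icc a b, ‖A (polyCurve (m + 1) (diffCoeff α) s)‖ ≤ ‖A v‖ := fun s hs => hmax hs
  suffices hvle : ‖A v‖ ≤ 2 * K * (‖U₀‖ + ∫ s in a..b, ‖f s‖) + c * ‖G₀‖ from
    fun s hs => (hM s hs).trans hvle
  have hG := local_grad_le hc hab hα h hκ0 hκ hM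
  obtain ⟨ζ, hζd, hζK, hζ⟩ := hK a b hab s₀ hs₀
  have hK0 : 0 ≤ K := (abs_nonneg _).trans (hζK a (left_mem_Icc.2 hab.le))
  obtain ⟨W, hWd, hWζ, hWa⟩ := exists_poly_antideriv ζ (m + 1) hζd a
  have h1 := local_test_poly h hWd hvS
  rw [hWζ, hWa] at h1
  simp only [zero_mul, mul_zero, add_zero] at h1
  obtain ⟨φ, hφd, -, hφ⟩ := exists_poly_eval_eq m (diffCoeff α)
    ((innerSL ℝ (A v)).toLinearMap.comp A.toLinearMap)
  have hφ' : ∀ s, φ.derivative.eval s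
      = inner ℝ (A (polyCurve m (diffCoeff (diffCoeff α)) s)) (A v) := by
    intro s
    have e1 := φ.hasDerivAt s
    have e2 := ((innerSL ℝ (A v)).comp A).hasFDerivAt.comp_hasDerivAt s
      (hasDerivAt_polyCurve m (diffCoeff α) s)
    have e3 : (fun s => φ.eval s)
        = ((innerSL ℝ (A v)).comp A) ∘ polyCurve (m + 1) (diffCoeff α) := by
      ext s
      rw [hφ s]
      rfl
    rw [e3] at e1
    rw [e1.unique e2]
    exact real_inner_comm _ _
  have hφ2 : ∀ s, φ.eval s = inner ℝ (A (polyCurve (m + 1) (diffCoeff α) s)) (A v) := by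
    intro s
    rw [hφ s]
    exact real_inner_comm _ _
  have h2 := hζ φ hφd
  rw [hφ2 s₀, ← hv, real_inner_self_eq_norm_sq, hφ2 a] at h2
  simp only [hφ'] at h2
  simp only [mul_comm (ζ.eval _)] at h1
  set I₁ := ∫ s in a..b, inner ℝ (B (polyCurve (m + 2) α s)) (B v) * ζ.eval s with hI₁
  set I₂ := ∫ s in a..b, inner ℝ (f s) (A v) * ζ.eval s with hI₂
  have hF0 : 0 ≤ ∫ s in a..b, ‖f s‖ :=
    intervalIntegral.integral_nonneg hab.le fun _ _ => norm_nonneg _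
  have b1 : c ^ 2 * |I₁| ≤ K * (c * (b - a) * κ) * (c * ‖G₀‖ + c * (b - a) * κ * ‖A v‖) * ‖A v‖ := by
    have : ‖I₁‖ ≤ ((‖G₀‖ + (b - a) * κ * ‖A v‖) * (κ * ‖A v‖) * K) * |b - a| := by
      refine intervalIntegral.norm_integral_le_of_norm_le_const fun s hs => ?_
      rw [uIoc_of_le hab.le] at hs
      have hs' : s ∈ Icc a b := Ioc_subset_Icc_self hs
      rw [norm_mul]
      refine mul_le_mul ((norm_inner_le_norm _ _).trans ?_) (hζK s hs') (norm_nonneg _) ?_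
      · refine mul_le_mul ?_ (hκ v hvS) (norm_nonneg _) ?_
        · refine le_of_mul_le_mul_left ((hG s hs').trans_eq ?_) hc
          ring
        · have := sub_pos.2 hab; positivity
      · have := sub_pos.2 hab; positivity
    rw [abs_of_pos (sub_pos.2 hab), Real.norm_eq_abs] at this
    calc c ^ 2 * |I₁| ≤ _ := mul_le_mul_of_nonneg_left this (by positivity)
      _ = _ := by ring
  have b2 : |I₂| ≤ K * (∫ s in a..b, ‖f s‖) * ‖A v‖ := by
    have : ‖I₂‖ ≤ ∫ s in a..b, ‖f s‖ * (‖A v‖ * K) := by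
      refine intervalIntegral.norm_integral_le_of_norm_le hab.le (ae_of_all _ fun s hs => ?_)
        (hf.norm.mul_const _)
      rw [norm_mul, ← mul_assoc]
      exact mul_le_mul (norm_inner_le_norm _ _) (hζK s (Ioc_subset_Icc_self hs)) (norm_nonneg _)
        (by positivity)
    rw [intervalIntegral.integral_mul_const, Real.norm_eq_abs] at this
    linarith
  have b3 : |inner ℝ U₀ (A v) * ζ.eval a| ≤ K * ‖U₀‖ * ‖A v‖ := by
    rw [abs_mul]
    calc _ ≤ ‖U₀‖ * ‖A v‖ * K := mul_le_mul (abs_real_inner_le_norm _ _)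
          (hζK a (left_mem_Icc.2 hab.le)) (abs_nonneg _) (by positivity)
      _ = _ := by ring
  rcases eq_or_lt_of_le (norm_nonneg (A v)) with h0 | hpos
  · rw [← h0]; positivity
  have key : ‖A v‖ ^ 2 ≤ (K * ‖U₀‖ + K * (∫ s in a..b, ‖f s‖)
      + K * (c * (b - a) * κ) * (c * ‖G₀‖ + c * (b - a) * κ * ‖A v‖)) * ‖A v‖ := by
    have e1 := neg_abs_le I₁
    have e2 := le_abs_self I₂
    have e3 := le_abs_self (inner ℝ U₀ (A v) * ζ.eval a)
    nlinarith [mul_le_mul_of_nonneg_left e1 (sq_nonneg c)]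
  rw [sq] at key
  have key2 := le_of_mul_le_mul_right key hpos
  have hε0 : 0 ≤ c * (b - a) * κ := by have := sub_pos.2 hab; positivity
  have e4 : K * (c * (b - a) * κ) * (c * ‖G₀‖ + c * (b - a) * κ * ‖A v‖)
      ≤ 1 / 2 * (c * ‖G₀‖ + 1 * ‖A v‖) := by
    gcongr
  linarith

/-- One time step has at most one solution on `[a, b]`. -/
lemma local_unique {A : E →L[ℝ] X} {B : E →L[ℝ] Y} {c : ℝ} (hc : 0 < c) {m : ℕ} {a b : ℝ}
    (hab : a < b) {f : ℝ → X}
    {U₀ : X} {G₀ : Y} {α α' : ℕ → E} {S : Submodule ℝ E}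
    (hα : ∀ j, α j ∈ S) (hα' : ∀ j, α' j ∈ S)
    (h : ∀ β : ℕ → E, (∀ j, β j ∈ S) →
      localForm A B c m a b α β = localLoad A B c m a b f U₀ G₀ β)
    (h' : ∀ β : ℕ → E, (∀ j, β j ∈ S) →
      localForm A B c m a b α' β = localLoad A B c m a b f U₀ G₀ β)
    {κ : ℝ} (hκ0 : 0 ≤ κ) (hκ : ∀ v ∈ S, ‖B v‖ ≤ κ * ‖A v‖) {K : ℝ} (hK : EvalBound m K)
    (hε : c * (b - a) * κ ≤ 1) (hKε : K * (c * (b - a) * κ) ≤ 1 / 2)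
    (hB : ∀ v ∈ S, B v = 0 → v = 0) :
    ∀ s ∈ Icc a b, polyCurve (m + 2) α s = polyCurve (m + 2) α' s := by
  have hγS : ∀ j, (α + (-1 : ℝ) • α') j ∈ S := fun j =>
    S.add_mem (hα j) (S.smul_mem _ (hα' j))
  have hγ : ∀ β : ℕ → E, (∀ j, β j ∈ S) →
      localForm A B c m a b (α + (-1 : ℝ) • α') β
        = localLoad A B c m a b (fun _ => (0 : X)) 0 (0 : Y) β := by
    intro β hβ
    rw [map_add, map_smul, LinearMap.add_apply, LinearMap.smul_apply, h β hβ, h' β hβ]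
    simp [localLoad]
  have h1 := local_deriv_le hc hab (_root_.intervalIntegrable_const) hγS hγ hκ0 hκ hK hε hKε
  have h2 := local_grad_le hc hab hγS hγ hκ0 hκ (M := 0) (by simpa using h1)
  intro s hs
  have h3 := h2 s hs
  have h4 : B (polyCurve (m + 2) (α + (-1 : ℝ) • α') s) = 0 := by
    rw [norm_zero, mul_zero, mul_zero, add_zero] at h3
    exact norm_le_zero_iff.1 (nonpos_of_mul_nonpos_right h3 hc)
  have h5 := hB _ (polyCurve_mem hγS _ _) h4
  rw [polyCurve_add, polyCurve_smul, neg_one_smul, ← sub_eq_add_neg] at h5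
  exact sub_eq_zero.1 h5

/-- A family of `k` coefficients, extended by zero. -/
noncomputable def extendCoeff (S : Submodule ℝ E) (k : ℕ) : (Fin k → S) →ₗ[ℝ] (ℕ → E) where
  toFun w j := if h : j < k then (w ⟨j, h⟩ : E) else 0
  map_add' w w' := by
    ext j
    by_cases h : j < k <;> simp [h]
  map_smul' r w := by
    ext j
    by_cases h : j < k <;> simp [h]

lemma extendCoeff_mem (S : Submodule ℝ E) (k : ℕ) (w : Fin k → S) (j : ℕ) :
    extendCoeff S k w j ∈ S := by
  by_cases h : j < k <;> simp [extendCoeff, h]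

lemma extendCoeff_apply (S : Submodule ℝ E) {k : ℕ} (w : Fin k → S) {j : ℕ} (h : j < k) :
    extendCoeff S k w j = w ⟨j, h⟩ := by
  simp [extendCoeff, h]

/-- One time step is solvable: it is a square linear system with at most one solution. -/
lemma local_exists {A : E →L[ℝ] X} {B : E →L[ℝ] Y} {c : ℝ} (hc : 0 < c) {m : ℕ} {a b : ℝ}
    (hab : a < b) {f : ℝ → X} (hf : IntervalIntegrable f volume a b)
    (U₀ : X) (G₀ : Y) {S : Submodule ℝ E} [FiniteDimensional ℝ S]
    {κ : ℝ} (hκ0 : 0 ≤ κ) (hκ : ∀ v ∈ S, ‖B v‖ ≤ κ * ‖A v‖) {K : ℝ} (hK : EvalBound m K)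
    (hε : c * (b - a) * κ ≤ 1) (hKε : K * (c * (b - a) * κ) ≤ 1 / 2)
    (hB : ∀ v ∈ S, B v = 0 → v = 0) :
    ∃ α : ℕ → E, (∀ j, α j ∈ S) ∧ ∀ β : ℕ → E, (∀ j, β j ∈ S) →
      localForm A B c m a b α β = localLoad A B c m a b f U₀ G₀ β := by
  let ext := extendCoeff S (m + 2)
  let L : (Fin (m + 2) → S) →ₗ[ℝ] Module.Dual ℝ (Fin (m + 2) → S) :=
    (localForm A B c m a b).compl₁₂ ext ext
  -- Only the first `m + 2` coefficients of a test function matter.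
  have hred : ∀ β : ℕ → E, (∀ j, β j ∈ S) → ∃ w : Fin (m + 2) → S,
      (∀ s, polyCurve (m + 1) (diffCoeff (ext w)) s = polyCurve (m + 1) (diffCoeff β) s) ∧
      ∀ s, polyCurve (m + 2) (ext w) s = polyCurve (m + 2) β s := by
    intro β hβ
    refine ⟨fun j => ⟨β j, hβ j⟩, fun s => polyCurve_congr (fun j hj => ?_) s,
      fun s => polyCurve_congr (fun j hj => ?_) s⟩
    · rw [diffCoeff, diffCoeff, extendCoeff_apply S _ (by omega : j + 1 < m + 2)]
    · rw [extendCoeff_apply S _ hj]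
  have hinj : Function.Injective L := by
    rw [← LinearMap.ker_eq_bot, LinearMap.ker_eq_bot']
    intro w hw
    have h0 : ∀ β : ℕ → E, (∀ j, β j ∈ S) → localForm A B c m a b (ext w) β
        = localLoad A B c m a b (fun _ => (0 : X)) 0 (0 : Y) β := by
      intro β hβ
      obtain ⟨w', h1, h2⟩ := hred β hβ
      have h3 : localForm A B c m a b (ext w) (ext w') = 0 := LinearMap.congr_fun hw w'
      rw [localForm_apply] at h3 ⊢
      simp only [h1, h2] at h3
      rw [h3]
      simp [localLoad]
    have h0' : ∀ β : ℕ → E, (∀ j, β j ∈ S) → localForm A B c m a b (0 : ℕ → E) β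
        = localLoad A B c m a b (fun _ => (0 : X)) 0 (0 : Y) β := by
      intro β _
      simp [localLoad]
    have h1 := local_unique hc hab (extendCoeff_mem S _ w) (fun _ => S.zero_mem) h0 h0'
      hκ0 hκ hK hε hKε hB
    have h2 := coeff_eq_zero_of_polyCurve_eq_zero hab
      (fun s hs => (h1 s hs).trans (polyCurve_zero _ s))
    ext j
    rw [← extendCoeff_apply S w j.2]
    simpa using h2 j j.2
  have hsurj : Function.Surjective L :=
    (LinearMap.injective_iff_surjective_of_finrank_eq_finrank
      Subspace.dual_finrank_eq.symm).1 hinj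
  obtain ⟨w, hw⟩ := hsurj
    { toFun := fun w' => localLoad A B c m a b f U₀ G₀ (ext w')
      map_add' := fun w₁ w₂ => by rw [map_add, localLoad_add A B c m hf]
      map_smul' := fun r w' => by rw [map_smul, localLoad_smul]; rfl }
  refine ⟨ext w, extendCoeff_mem S _ w, fun β hβ => ?_⟩
  obtain ⟨w', h1, h2⟩ := hred β hβ
  have h3 : localForm A B c m a b (ext w) (ext w')
      = localLoad A B c m a b f U₀ G₀ (ext w') := LinearMap.congr_fun hw w'
  rw [localForm_apply, localLoad] at h3 ⊢
  simpa only [h1, h2] using h3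

end Local

/-! ### The inverse estimate for polynomials on balls -/

/-- The function on `ℝ^d` defined by a polynomial. -/
noncomputable def polyFun {d : ℕ} (P : MvPolynomial (Fin d) ℝ) (x : Space d) : ℝ :=
  MvPolynomial.eval (fun i => x i) P

lemma analyticOnNhd_polyFun {d : ℕ} (P : MvPolynomial (Fin d) ℝ) :
    AnalyticOnNhd ℝ (polyFun P) univ :=
  AnalyticOnNhd.eval_continuousLinearMap
    (EuclideanSpace.equiv (Fin d) ℝ : Space d →L[ℝ] (Fin d → ℝ)) P

lemma contDiff_polyFun {d : ℕ} (P : MvPolynomial (Fin d) ℝ) : ContDiff ℝ ∞ (polyFun P) :=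
  contDiff_iff_contDiffAt.2 fun x => (analyticOnNhd_polyFun P x trivial).contDiffAt

lemma continuous_gradient {d : ℕ} {φ : Space d → ℝ} (hφ : ContDiff ℝ ∞ φ) :
    Continuous (gradient φ) :=
  (InnerProductSpace.toDual ℝ (Space d)).symm.continuous.comp (hφ.continuous_fderiv (by simp))

lemma polyFun_add {d : ℕ} (P Q : MvPolynomial (Fin d) ℝ) :
    polyFun (P + Q) = polyFun P + polyFun Q := by
  ext x; simp [polyFun]

lemma polyFun_smul {d : ℕ} (r : ℝ) (P : MvPolynomial (Fin d) ℝ) :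
    polyFun (r • P) = r • polyFun P := by
  ext x; simp [polyFun, MvPolynomial.smul_eval]

lemma gradient_add' {d : ℕ} {φ ψ : Space d → ℝ} (hφ : ContDiff ℝ ∞ φ) (hψ : ContDiff ℝ ∞ ψ) :
    gradient (φ + ψ) = gradient φ + gradient ψ := by
  ext1 x
  simp only [gradient, Pi.add_apply]
  rw [fderiv_add (hφ.differentiable (by simp) x) (hψ.differentiable (by simp) x), map_add]

lemma gradient_smul' {d : ℕ} (r : ℝ) {φ : Space d → ℝ} (hφ : ContDiff ℝ ∞ φ) :
    gradient (r • φ) = r • gradient φ := by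
  ext1 x
  simp only [gradient, Pi.smul_apply]
  rw [fderiv_const_smul (hφ.differentiable (by simp) x), map_smul]

lemma polyFun_eq_zero {d : ℕ} {P : MvPolynomial (Fin d) ℝ} {U : Set (Space d)} (hU : IsOpen U)
    (hne : U.Nonempty) (h : ∀ x ∈ U, polyFun P x = 0) : P = 0 := by
  obtain ⟨x₀, hx₀⟩ := hne
  have h1 : polyFun P = 0 :=
    (analyticOnNhd_polyFun P).eq_of_eventuallyEq analyticOnNhd_const
      (eventually_of_mem (hU.mem_nhds hx₀) h)
  refine MvPolynomial.funext fun x => ?_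
  simpa [polyFun] using congrFun h1 (WithLp.toLp 2 x)

/-- Polynomials of bounded total degree are stable under dilations and translations. -/
lemma exists_polyFun_comp_affine {d : ℕ} (P : MvPolynomial (Fin d) ℝ) (x₀ : Space d) (h : ℝ) :
    ∃ Q : MvPolynomial (Fin d) ℝ, Q.totalDegree ≤ P.totalDegree ∧
      ∀ y, polyFun Q y = polyFun P (x₀ + h • y) := by
  refine ⟨∑ s ∈ P.support, MvPolynomial.C (P.coeff s) *
    ∏ i, (MvPolynomial.C (x₀ i) + MvPolynomial.C h * MvPolynomial.X i) ^ s i, ?_, ?_⟩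
  · refine MvPolynomial.totalDegree_finsetSum_le fun s hs => ?_
    refine (MvPolynomial.totalDegree_mul _ _).trans ?_
    rw [MvPolynomial.totalDegree_C, zero_add]
    refine (MvPolynomial.totalDegree_finsetProd _ _).trans ?_
    refine le_trans ?_ (MvPolynomial.le_totalDegree hs)
    rw [Finsupp.sum_fintype _ _ (fun _ => rfl)]
    refine Finset.sum_le_sum fun i _ => ?_
    refine (MvPolynomial.totalDegree_pow _ _).trans ?_
    have h1 : (MvPolynomial.C (x₀ i) + MvPolynomial.C h * MvPolynomial.X i :
        MvPolynomial (Fin d) ℝ).totalDegree ≤ 1 := by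
      refine (MvPolynomial.totalDegree_add _ _).trans (max_le (by simp) ?_)
      refine (MvPolynomial.totalDegree_mul _ _).trans ?_
      simp
    nlinarith
  · intro y
    simp only [polyFun]
    rw [MvPolynomial.eval_eq' _ P]
    simp [map_sum, map_prod]

lemma memLp_restrict_closedBall {d : ℕ} {F : Type*} [NormedAddCommGroup F] {g : Space d → F}
    (hg : Continuous g) (r : ℝ) :
    MemLp g 2 (volume.restrict (Metric.closedBall (0 : Space d) r)) := by
  obtain ⟨C, hC⟩ := (isCompact_closedBall (0 : Space d) r).exists_bound_of_continuousOn
    hg.continuousOn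
  have : IsFiniteMeasure (volume.restrict (Metric.closedBall (0 : Space d) r)) :=
    isFiniteMeasure_restrict.2 (isCompact_closedBall _ _).measure_lt_top.ne
  refine MemLp.of_bound hg.aestronglyMeasurable C ?_
  filter_upwards [ae_restrict_mem Metric.isClosed_closedBall.measurableSet] with x hx
  exact hC x hx

lemma norm_toLp_sq {α F : Type*} [MeasurableSpace α] {μ : Measure α} [NormedAddCommGroup F]
    [InnerProductSpace ℝ F] {g : α → F} (hg : MemLp g 2 μ) :
    ‖hg.toLp g‖ ^ 2 = ∫ x, ‖g x‖ ^ 2 ∂μ := by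
  rw [← real_inner_self_eq_norm_sq, L2.inner_def]
  refine integral_congr_ae ?_
  filter_upwards [hg.coeFn_toLp] with x hx
  rw [hx, real_inner_self_eq_norm_sq]

/-- On a finite-dimensional space, every linear map is bounded by any injective linear map. -/
lemma exists_norm_le_of_injective {V E F : Type*} [AddCommGroup V] [Module ℝ V]
    [FiniteDimensional ℝ V] [NormedAddCommGroup E] [NormedSpace ℝ E] [NormedAddCommGroup F]
    [NormedSpace ℝ F] (i : V →ₗ[ℝ] E) (hi : Function.Injective i) (D : V →ₗ[ℝ] F) :
    ∃ C : ℝ, 0 ≤ C ∧ ∀ v, ‖D v‖ ≤ C * ‖i v‖ := by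
  let e := LinearEquiv.ofInjective i hi
  let T : LinearMap.range i →L[ℝ] F := (D.comp e.symm.toLinearMap).toContinuousLinearMap
  refine ⟨‖T‖, T.opNorm_nonneg, fun v => ?_⟩
  have h := T.le_opNorm (e v)
  have h1 : T (e v) = D v := by simp [T]
  rw [h1] at h
  exact h

/-- The inverse estimate on concentric reference balls, by finite dimensionality. -/
lemma exists_inverse_unit (d p : ℕ) {r : ℝ} (hr : 0 < r) :
    ∃ C : ℝ, 0 ≤ C ∧ ∀ P : MvPolynomial (Fin d) ℝ, P.totalDegree ≤ p →
      ∫ x in Metric.closedBall (0 : Space d) 1, ‖gradient (polyFun P) x‖ ^ 2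
        ≤ C ^ 2 * ∫ x in Metric.closedBall (0 : Space d) r, ‖polyFun P x‖ ^ 2 := by
  have m1 : ∀ P : MvPolynomial (Fin d) ℝ, MemLp (polyFun P) 2
      (volume.restrict (Metric.closedBall (0 : Space d) r)) := fun P =>
    memLp_restrict_closedBall (contDiff_polyFun P).continuous r
  have m2 : ∀ P : MvPolynomial (Fin d) ℝ, MemLp (gradient (polyFun P)) 2
      (volume.restrict (Metric.closedBall (0 : Space d) 1)) := fun P =>
    memLp_restrict_closedBall (continuous_gradient (contDiff_polyFun P)) 1
  let i : MvPolynomial (Fin d) ℝ →ₗ[ℝ]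
      Lp ℝ 2 (volume.restrict (Metric.closedBall (0 : Space d) r)) :=
    { toFun := fun P => (m1 P).toLp _
      map_add' := fun P Q => by
        rw [← MemLp.toLp_add]
        exact MemLp.toLp_congr _ _ (by rw [polyFun_add])
      map_smul' := fun s P => by
        rw [RingHom.id_apply, ← MemLp.toLp_const_smul]
        exact MemLp.toLp_congr _ _ (by rw [polyFun_smul]) }
  let D : MvPolynomial (Fin d) ℝ →ₗ[ℝ]
      Lp (Space d) 2 (volume.restrict (Metric.closedBall (0 : Space d) 1)) :=
    { toFun := fun P => (m2 P).toLp _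
      map_add' := fun P Q => by
        rw [← MemLp.toLp_add]
        exact MemLp.toLp_congr _ _ (by
          rw [polyFun_add, gradient_add' (contDiff_polyFun P) (contDiff_polyFun Q)])
      map_smul' := fun s P => by
        rw [RingHom.id_apply, ← MemLp.toLp_const_smul]
        exact MemLp.toLp_congr _ _ (by
          rw [polyFun_smul, gradient_smul' s (contDiff_polyFun P)]) }
  have hi : Function.Injective
      (i.comp (MvPolynomial.restrictTotalDegree (Fin d) ℝ p).subtype) := by
    rw [← LinearMap.ker_eq_bot, LinearMap.ker_eq_bot']
    intro P hP
    have h0 : (m1 P).toLp _ = 0 := hP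
    have h1 : polyFun (P : MvPolynomial (Fin d) ℝ)
        =ᵐ[volume.restrict (Metric.ball (0 : Space d) r)] 0 := by
      have := (m1 P).coeFn_toLp
      rw [h0] at this
      have h2 := (this.symm.trans (Lp.coeFn_zero _ _ _))
      exact ae_restrict_of_ae_restrict_of_subset Metric.ball_subset_closedBall h2
    have h2 := Measure.eqOn_open_of_ae_eq h1 Metric.isOpen_ball
      (contDiff_polyFun _).continuous.continuousOn continuousOn_const
    exact Subtype.ext (polyFun_eq_zero Metric.isOpen_ball (Metric.nonempty_ball.2 hr)
      fun x hx => h2 hx)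
  obtain ⟨C, hC0, hC⟩ := exists_norm_le_of_injective _ hi
    (D.comp (MvPolynomial.restrictTotalDegree (Fin d) ℝ p).subtype)
  refine ⟨C, hC0, fun P hP => ?_⟩
  have h := hC ⟨P, (MvPolynomial.mem_restrictTotalDegree _ _ _).2 hP⟩
  have h' : ‖(m2 P).toLp _‖ ≤ C * ‖(m1 P).toLp _‖ := h
  rw [← norm_toLp_sq (m2 P), ← norm_toLp_sq (m1 P), ← mul_pow]
  exact pow_le_pow_left₀ (norm_nonneg _) h' 2

lemma setIntegral_closedBall_comp_affine {d : ℕ} (g : Space d → ℝ) (x₀ : Space d) {h r : ℝ}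
    (hh : 0 < h) (hr : 0 ≤ r) :
    ∫ y in Metric.closedBall (0 : Space d) r, g (x₀ + h • y)
      = (h ^ Module.finrank ℝ (Space d))⁻¹ * ∫ x in Metric.closedBall x₀ (h * r), g x := by
  rw [Measure.setIntegral_comp_smul_of_pos volume (fun z => g (x₀ + z)) _ hh,
    smul_closedBall _ _ hr, smul_zero, Real.norm_of_nonneg hh.le, smul_eq_mul]
  congr 1
  have h1 := (measurePreserving_add_left (volume : Measure (Space d)) x₀).setIntegral_preimage_emb
    (measurableEmbedding_addLeft x₀) g (Metric.closedBall x₀ (h * r))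
  rw [← h1]
  congr 2
  ext z
  simp [Metric.mem_closedBall, dist_eq_norm]

/-- The inverse estimate between the balls of radius `h r` and `h` about a point, by scaling. -/
lemma exists_inverse_ball (d p : ℕ) {r : ℝ} (hr : 0 < r) :
    ∃ C : ℝ, 0 ≤ C ∧ ∀ P : MvPolynomial (Fin d) ℝ, P.totalDegree ≤ p →
      ∀ (x₀ : Space d) (h : ℝ), 0 < h →
      ∫ x in Metric.closedBall x₀ h, ‖gradient (polyFun P) x‖ ^ 2
        ≤ (C / h) ^ 2 * ∫ x in Metric.closedBall x₀ (h * r), ‖polyFun P x‖ ^ 2 := by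
  obtain ⟨C, hC0, hC⟩ := exists_inverse_unit d p hr
  refine ⟨C, hC0, fun P hP x₀ h hh => ?_⟩
  obtain ⟨Q, hQd, hQ⟩ := exists_polyFun_comp_affine P x₀ h
  have hgrad : ∀ y, gradient (polyFun Q) y = h • gradient (polyFun P) (x₀ + h • y) := by
    intro y
    have e : polyFun Q = fun y => polyFun P (x₀ + h • y) := funext hQ
    have h1 : HasFDerivAt (fun y : Space d => x₀ + h • y)
        (h • ContinuousLinearMap.id ℝ (Space d)) y :=
      ((hasFDerivAt_id y).const_smul h).const_add x₀
    have h2 := (((contDiff_polyFun P).differentiable (by simp)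
      (x₀ + h • y)).hasFDerivAt.comp y h1).fderiv
    simp only [gradient]
    rw [← map_smul]
    congr 1
    rw [e]
    refine Eq.trans h2 ?_
    ext z
    simp
  have h3 := hC Q (hQd.trans hP)
  simp only [hQ, hgrad, norm_smul, mul_pow, Real.norm_of_nonneg hh.le] at h3
  rw [integral_const_mul, setIntegral_closedBall_comp_affine
    (fun x => ‖gradient (polyFun P) x‖ ^ 2) x₀ hh zero_le_one,
    setIntegral_closedBall_comp_affine (fun x => ‖polyFun P x‖ ^ 2) x₀ hh hr.le, mul_one] at h3
  have hpow : 0 < (h ^ Module.finrank ℝ (Space d))⁻¹ := by positivity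
  rw [div_pow, div_mul_eq_mul_div, le_div_iff₀ (by positivity)]
  refine le_of_mul_le_mul_left ?_ hpow
  linarith

/-! ### Weak gradients of functions in `H¹₀(Ω)` -/

section H10

variable {d : ℕ} {Ω : Set (Space d)}

/-- The embedding of `H¹₀(Ω)` in `L²(Ω)` as a continuous linear map. -/
noncomputable def valL (Ω : Set (Space d)) : H10 Ω →L[ℝ] L2 Ω :=
  (ContinuousLinearMap.fst ℝ (L2 Ω) (L2Vec Ω)).comp (H10Submodule Ω).subtypeL

/-- The gradient on `H¹₀(Ω)` as a continuous linear map. -/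
noncomputable def gradL (Ω : Set (Space d)) : H10 Ω →L[ℝ] L2Vec Ω :=
  (ContinuousLinearMap.snd ℝ (L2 Ω) (L2Vec Ω)).comp (H10Submodule Ω).subtypeL

lemma valL_apply (v : H10 Ω) : valL Ω v = val v := rfl

lemma gradL_apply (v : H10 Ω) : gradL Ω v = grad v := rfl

lemma continuous_fderiv_apply' {φ : Space d → ℝ} (hφ : ContDiff ℝ ∞ φ) (e : Space d) :
    Continuous fun x => fderiv ℝ φ x e :=
  (hφ.continuous_fderiv (by simp)).clm_apply continuous_const

lemma hasCompactSupport_fderiv_apply' {φ : Space d → ℝ} (hφ : HasCompactSupport φ) (e : Space d) :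
    HasCompactSupport fun x => fderiv ℝ φ x e :=
  (hφ.fderiv ℝ).comp_left (g := fun T : Space d →L[ℝ] ℝ => T e) rfl

lemma setIntegral_eq_integral_of_tsupport {φ : Space d → ℝ} (hΩ : tsupport φ ⊆ Ω) {g : Space d → ℝ}
    (hg : ∀ x, x ∉ tsupport φ → g x = 0) : ∫ x in Ω, g x = ∫ x, g x :=
  setIntegral_eq_integral_of_forall_compl_eq_zero fun x hx => hg x fun h => hx (hΩ h)

/-- Integration by parts when one factor is a test function. -/
lemma integral_test_parts {φ g : Space d → ℝ} (hφ : ContDiff ℝ ∞ φ) (hφc : HasCompactSupport φ)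
    (hg : ContDiff ℝ ∞ g) (e : Space d) :
    ∫ x, φ x * fderiv ℝ g x e = -∫ x, g x * fderiv ℝ φ x e := by
  have i1 : Integrable (fun x => fderiv ℝ φ x e * g x) :=
    ((continuous_fderiv_apply' hφ e).mul hg.continuous).integrable_of_hasCompactSupport
      (hasCompactSupport_fderiv_apply' hφc e).mul_right
  have i2 : Integrable (fun x => φ x * fderiv ℝ g x e) :=
    (hφ.continuous.mul (continuous_fderiv_apply' hg e)).integrable_of_hasCompactSupport
      hφc.mul_right
  have i3 : Integrable (fun x => φ x * g x) :=
    (hφ.continuous.mul hg.continuous).integrable_of_hasCompactSupport hφc.mul_right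
  rw [integral_mul_fderiv_eq_neg_fderiv_mul_of_integrable i1 i2 i3
    (fun x _ => hφ.differentiable (by simp) x) (fun x _ => hg.differentiable (by simp) x)]
  simp only [mul_comm]

lemma inner_toLp_left {F : Type*} [NormedAddCommGroup F] [InnerProductSpace ℝ F]
    {μ : Measure (Space d)} {g : Space d → F} (hg : MemLp g 2 μ) (z : Lp F 2 μ) :
    inner ℝ (hg.toLp g) z = ∫ x, inner ℝ (g x) (z x) ∂μ := by
  rw [L2.inner_def]
  refine integral_congr_ae ?_
  filter_upwards [hg.coeFn_toLp] with x hx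
  rw [hx]

/-- The defining relation of the weak gradient, for test functions on all of `ℝ^d`. -/
lemma integral_mul_grad (v : H10 Ω) {ψ : Space d → ℝ} (hψ : ContDiff ℝ ∞ ψ)
    (hψc : HasCompactSupport ψ) (e : Space d) :
    ∫ x in Ω, ψ x * inner ℝ e (grad v x) = -∫ x in Ω, fderiv ℝ ψ x e * val v x := by
  have m1 : MemLp (fun x => ψ x • e) 2 (volume.restrict Ω) :=
    ((hψ.continuous.smul continuous_const).memLp_of_hasCompactSupport hψc.smul_right).restrict Ω
  have m2 : MemLp (fun x => fderiv ℝ ψ x e) 2 (volume.restrict Ω) :=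
    ((continuous_fderiv_apply' hψ e).memLp_of_hasCompactSupport
      (hasCompactSupport_fderiv_apply' hψc e)).restrict Ω
  let ℓ : L2 Ω × L2Vec Ω →L[ℝ] ℝ :=
    (innerSL ℝ (m2.toLp _)).comp (ContinuousLinearMap.fst ℝ (L2 Ω) (L2Vec Ω))
      + (innerSL ℝ (m1.toLp _)).comp (ContinuousLinearMap.snd ℝ (L2 Ω) (L2Vec Ω))
  have hℓ : ∀ z : L2 Ω × L2Vec Ω, ℓ z = (∫ x in Ω, fderiv ℝ ψ x e * z.1 x)
      + ∫ x in Ω, ψ x * inner ℝ e (z.2 x) := by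
    intro z
    have : ℓ z = inner ℝ (m2.toLp _) z.1 + inner ℝ (m1.toLp _) z.2 := rfl
    rw [this, inner_toLp_left, inner_toLp_left]
    simp only [inner_smul_left, RCLike.conj_to_real]
    congr 1
    refine integral_congr_ae (ae_of_all _ fun x => ?_)
    exact mul_comm _ _
  have hle : H10Submodule Ω ≤ LinearMap.ker ℓ.toLinearMap := by
    refine Submodule.topologicalClosure_minimal _ (Submodule.span_le.2 ?_) ℓ.isClosed_ker
    rintro z ⟨φ, hφ, hφc, hφΩ, h1, h2⟩
    change ℓ z = 0
    have e1 : ∫ x in Ω, fderiv ℝ ψ x e * z.1 x = ∫ x, φ x * fderiv ℝ ψ x e := by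
      rw [← setIntegral_eq_integral_of_tsupport hφΩ
        (fun x hx => by rw [image_eq_zero_of_notMem_tsupport hx, zero_mul])]
      refine integral_congr_ae ?_
      filter_upwards [h1] with x hx
      rw [hx, mul_comm]
    have e2 : ∫ x in Ω, ψ x * inner ℝ e (z.2 x) = ∫ x, ψ x * fderiv ℝ φ x e := by
      rw [← setIntegral_eq_integral_of_tsupport hφΩ (fun x hx => by
        rw [fderiv_of_notMem_tsupport ℝ hx]; simp)]
      refine integral_congr_ae ?_
      filter_upwards [h2] with x hx
      rw [hx, real_inner_comm, inner_gradient_left]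
    rw [hℓ, e1, e2, integral_test_parts hφ hφc hψ]
    simp
  have h := hℓ v
  rw [show ℓ v = 0 from hle v.2] at h
  have h' : (0 : ℝ) = (∫ x in Ω, fderiv ℝ ψ x e * val v x)
      + ∫ x in Ω, ψ x * inner ℝ e (grad v x) := h
  linarith

/-- Where a function in `H¹₀(Ω)` agrees with a smooth function, so do the gradients. -/
lemma grad_ae_eq_gradient (v : H10 Ω) {U : Set (Space d)} (hU : IsOpen U)
    (hUΩ : U ⊆ Ω) {g : Space d → ℝ} (hg : ContDiff ℝ ∞ g)
    (h : ∀ᵐ x ∂(volume.restrict Ω), x ∈ U → val v x = g x) :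
    ∀ᵐ x ∂(volume.restrict Ω), x ∈ U → grad v x = gradient g x := by
  have hv2 : LocallyIntegrable (grad v) (volume.restrict Ω) :=
    (Lp.memLp (grad v)).locallyIntegrable (by norm_num)
  have hg2 : LocallyIntegrable (gradient g) (volume.restrict Ω) :=
    (continuous_gradient hg).locallyIntegrable
  have key := hU.ae_eq_zero_of_integral_contDiff_smul_eq_zero (μ := volume.restrict Ω)
    (f := fun x => grad v x - gradient g x) ((hv2.sub hg2).locallyIntegrableOn U) ?_
  · filter_upwards [key] with x hx hxU
    exact sub_eq_zero.1 (hx hxU)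
  intro ψ hψ hψc hψU
  have i1 : Integrable (fun x => ψ x • grad v x) (volume.restrict Ω) :=
    hv2.integrable_smul_left_of_hasCompactSupport hψ.continuous hψc
  have i2 : Integrable (fun x => ψ x • gradient g x) (volume.restrict Ω) :=
    hg2.integrable_smul_left_of_hasCompactSupport hψ.continuous hψc
  refine ext_inner_left ℝ fun e => ?_
  rw [inner_zero_right]
  simp only [smul_sub]
  rw [integral_sub i1 i2, inner_sub_right, ← integral_inner i1, ← integral_inner i2]
  simp only [inner_smul_right]
  have e1 : ∫ x in Ω, fderiv ℝ ψ x e * val v x = ∫ x, g x * fderiv ℝ ψ x e := by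
    rw [← setIntegral_eq_integral_of_tsupport (hψU.trans hUΩ) (fun x hx => by
        rw [fderiv_of_notMem_tsupport ℝ hx]; simp)]
    refine integral_congr_ae ?_
    filter_upwards [h] with x hx
    by_cases hxs : x ∈ tsupport ψ
    · rw [hx (hψU hxs), mul_comm]
    · rw [fderiv_of_notMem_tsupport ℝ hxs]; simp
  have e2 : ∫ x in Ω, ψ x * inner ℝ e (gradient g x) = ∫ x, ψ x * fderiv ℝ g x e := by
    rw [← setIntegral_eq_integral_of_tsupport (hψU.trans hUΩ) (fun x hx => by
        rw [image_eq_zero_of_notMem_tsupport hx, zero_mul])]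
    refine integral_congr_ae (ae_of_all _ fun x => ?_)
    simp only
    rw [real_inner_comm, inner_gradient_left]
  rw [integral_mul_grad v hψ hψc, e1, e2, integral_test_parts hψ hψc hg]
  simp

/-- A function in `H¹₀(Ω)` determines its weak gradient. -/
lemma eq_zero_of_val_eq_zero (hΩ : IsOpen Ω) {v : H10 Ω} (h : val v = 0) : v = 0 := by
  have h1 := grad_ae_eq_gradient v hΩ subset_rfl (g := 0) contDiff_const (by
    rw [h]
    filter_upwards [Lp.coeFn_zero ℝ 2 (volume.restrict Ω)] with x hx _
    exact hx)
  have h2 : grad v = 0 := by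
    refine Lp.ext ?_
    filter_upwards [h1, Lp.coeFn_zero (Space d) 2 (volume.restrict Ω),
      ae_restrict_mem hΩ.measurableSet] with x hx h0 hxΩ
    rw [hx hxΩ, h0]
    exact gradient_const x 0
  exact Subtype.ext (Prod.ext h h2)

/-- The Poincaré inequality for a test function, from `∫ φ² = -2 ∫ x₁ φ ∂₁φ`. -/
lemma norm_le_of_test {R : ℝ} (hR0 : 0 ≤ R) (hR : ∀ x ∈ Ω, ‖x‖ ≤ R) (i : Fin d)
    {φ : Space d → ℝ} (hφ : ContDiff ℝ ∞ φ) (hφc : HasCompactSupport φ) (hφΩ : tsupport φ ⊆ Ω)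
    (hΩ : IsOpen Ω)
    {z : L2 Ω × L2Vec Ω} (h1 : z.1 =ᵐ[volume.restrict Ω] φ)
    (h2 : z.2 =ᵐ[volume.restrict Ω] gradient φ) :
    ‖z.1‖ ≤ 2 * R * ‖z.2‖ := by
  set e : Space d := EuclideanSpace.single i 1 with he
  set x₁ : Space d →L[ℝ] ℝ := EuclideanSpace.proj i with hx₁
  have he1 : ‖e‖ = 1 := by simp [he]
  have hxe : x₁ e = 1 := by simp [hx₁, he]
  have hφ2 : ContDiff ℝ ∞ (fun x => φ x * φ x) := hφ.mul hφ
  have hparts := integral_test_parts hφ2 hφc.mul_right x₁.contDiff e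
  have hfd : ∀ x, fderiv ℝ (fun x => φ x * φ x) x e = 2 * (φ x * fderiv ℝ φ x e) := by
    intro x
    have hd := hφ.differentiable (by simp) x
    rw [fderiv_fun_mul hd hd]
    simp
    ring
  simp only [ContinuousLinearMap.fderiv, hxe, hfd, mul_one] at hparts
  have m : MemLp (fun x => (x₁ x * φ x) • e) 2 (volume.restrict Ω) :=
    (((x₁.continuous.mul hφ.continuous).smul continuous_const).memLp_of_hasCompactSupport
      (hφc.mul_left.smul_right)).restrict Ω
  have hn : ‖z.1‖ ^ 2 = -(2 * inner ℝ (m.toLp _) z.2) := by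
    rw [← real_inner_self_eq_norm_sq, L2.inner_def, inner_toLp_left m]
    have a1 : ∫ x in Ω, inner ℝ (z.1 x) (z.1 x) = ∫ x, φ x * φ x := by
      rw [← setIntegral_eq_integral_of_tsupport hφΩ
        (fun x hx => by rw [image_eq_zero_of_notMem_tsupport hx, zero_mul])]
      refine integral_congr_ae ?_
      filter_upwards [h1] with x hx
      rw [hx]; rfl
    have a2 : ∫ x in Ω, inner ℝ ((x₁ x * φ x) • e) (z.2 x)
        = ∫ x, x₁ x * (φ x * fderiv ℝ φ x e) := by
      rw [← setIntegral_eq_integral_of_tsupport hφΩ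
        (fun x hx => by rw [image_eq_zero_of_notMem_tsupport hx, zero_mul, mul_zero])]
      refine integral_congr_ae ?_
      filter_upwards [h2] with x hx
      rw [hx, inner_smul_left, real_inner_comm, inner_gradient_left, RCLike.conj_to_real, mul_assoc]
    rw [a1, a2, hparts, ← integral_const_mul]
    congr 1
    refine integral_congr_ae (ae_of_all _ fun x => ?_)
    simp only
    ring
  have hm : ‖m.toLp _‖ ≤ R * ‖z.1‖ := by
    refine Lp.norm_le_mul_norm_of_ae_le_mul ?_
    filter_upwards [m.coeFn_toLp, h1, ae_restrict_mem hΩ.measurableSet] with x hx hz hxΩ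
    rw [hx, hz, norm_smul, he1, mul_one, norm_mul]
    refine mul_le_mul_of_nonneg_right ?_ (norm_nonneg _)
    exact (PiLp.norm_apply_le _ i).trans (hR x hxΩ)
  have hcs := abs_real_inner_le_norm (m.toLp _) z.2
  have h3 : ‖z.1‖ ^ 2 ≤ 2 * (R * ‖z.1‖ * ‖z.2‖) := by
    have := neg_abs_le (inner ℝ (m.toLp _) z.2)
    have := mul_le_mul_of_nonneg_right hm (norm_nonneg z.2)
    linarith
  rcases eq_or_lt_of_le (norm_nonneg z.1) with h0 | hpos
  · rw [← h0]
    positivity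
  · refine le_of_mul_le_mul_left ?_ hpos
    linarith

/-- The generators of `H¹₀(Ω)` already form a linear space. -/
lemma exists_test_of_mem_span {z : L2 Ω × L2Vec Ω}
    (hz : z ∈ Submodule.span ℝ {z : L2 Ω × L2Vec Ω | ∃ φ : Space d → ℝ,
      ContDiff ℝ ∞ φ ∧ HasCompactSupport φ ∧ tsupport φ ⊆ Ω ∧
      z.1 =ᵐ[volume.restrict Ω] φ ∧ z.2 =ᵐ[volume.restrict Ω] gradient φ}) :
    ∃ φ : Space d → ℝ, ContDiff ℝ ∞ φ ∧ HasCompactSupport φ ∧ tsupport φ ⊆ Ω ∧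
      z.1 =ᵐ[volume.restrict Ω] φ ∧ z.2 =ᵐ[volume.restrict Ω] gradient φ := by
  induction hz using Submodule.span_induction with
  | mem z hz => exact hz
  | zero =>
    refine ⟨0, contDiff_const, HasCompactSupport.zero, by simp, Lp.coeFn_zero _ _ _, ?_⟩
    filter_upwards [Lp.coeFn_zero (Space d) 2 (volume.restrict Ω)] with x hx
    exact hx.trans (gradient_const x 0).symm
  | add z w _ _ hz hw =>
    obtain ⟨φ, a1, a2, a3, a4, a5⟩ := hz
    obtain ⟨ψ, b1, b2, b3, b4, b5⟩ := hw
    refine ⟨φ + ψ, a1.add b1, a2.add b2, (tsupport_add φ ψ).trans (union_subset a3 b3), ?_, ?_⟩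
    · exact (Lp.coeFn_add _ _).trans (a4.add b4)
    · rw [gradient_add' a1 b1]
      exact (Lp.coeFn_add _ _).trans (a5.add b5)
  | smul r z _ hz =>
    obtain ⟨φ, a1, a2, a3, a4, a5⟩ := hz
    refine ⟨r • φ, contDiff_const.smul a1, a2.smul_left,
      (tsupport_smul_subset_right (fun _ => r) φ).trans a3, ?_, ?_⟩
    · exact (Lp.coeFn_smul _ _).trans (a4.const_smul r)
    · rw [gradient_smul' r a1]
      exact (Lp.coeFn_smul _ _).trans (a5.const_smul r)

/-- The Poincaré inequality in `H¹₀(Ω)` for a bounded open set `Ω`. -/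
lemma norm_val_le (hΩ : IsOpen Ω) {R : ℝ} (hR0 : 0 ≤ R) (hR : ∀ x ∈ Ω, ‖x‖ ≤ R) (hd : 1 ≤ d) (v : H10 Ω) :
    ‖val v‖ ≤ 2 * R * ‖grad v‖ := by
  have hcl : IsClosed {z : L2 Ω × L2Vec Ω | ‖z.1‖ ≤ 2 * R * ‖z.2‖} :=
    isClosed_le (by fun_prop) (by fun_prop)
  have hv : (v : L2 Ω × L2Vec Ω) ∈ closure _ := v.2
  refine closure_minimal ?_ hcl hv
  intro z hz
  obtain ⟨φ, a1, a2, a3, a4, a5⟩ := exists_test_of_mem_span hz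
  exact norm_le_of_test hR0 hR ⟨0, hd⟩ a1 a2 a3 hΩ a4 a5

lemma eq_zero_of_grad_eq_zero (hΩ : IsOpen Ω) (hb : Bornology.IsBounded Ω) (hd : 1 ≤ d)
    {v : H10 Ω} (h : grad v = 0) : v = 0 := by
  obtain ⟨R, hR0, hR⟩ := hb.exists_pos_norm_le
  have h1 := norm_val_le hΩ hR0.le hR hd v
  rw [h, norm_zero, mul_zero] at h1
  exact Subtype.ext (Prod.ext (norm_le_zero_iff.1 h1) h)

end H10

/-! ### Simplicial partitions and the finite element space -/

section Mesh

variable {d : ℕ} {Ω : Set (Space d)} {𝒯 : Geometry.SimplicialComplex ℝ (Space d)}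

lemma IsSimplicialPartition.finite_elements (h𝒯 : IsSimplicialPartition Ω 𝒯) :
    (elements 𝒯).Finite :=
  h𝒯.finite.subset fun _ hK => hK.1

lemma IsSimplicialPartition.subset_iUnion (h𝒯 : IsSimplicialPartition Ω 𝒯) :
    Ω ⊆ ⋃ K ∈ elements 𝒯, convexHull ℝ (K : Set (Space d)) :=
  subset_closure.trans h𝒯.closure_eq.subset

lemma isCompact_element (K : Finset (Space d)) : IsCompact (convexHull ℝ (K : Set (Space d))) :=
  K.finite_toSet.isCompact_convexHull (𝕜 := ℝ)

lemma IsSimplicialPartition.isBounded (h𝒯 : IsSimplicialPartition Ω 𝒯) :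
    Bornology.IsBounded Ω :=
  (h𝒯.finite_elements.isCompact_biUnion fun K _ => isCompact_element K).isBounded.subset
    h𝒯.subset_iUnion

/-- Distinct elements overlap in the convex hull of at most `d` points, which has no interior. -/
lemma disjoint_interior_element {K K' : Finset (Space d)} (hK : K ∈ elements 𝒯)
    (hK' : K' ∈ elements 𝒯) (hne : K ≠ K') :
    Disjoint (interior (convexHull ℝ (K : Set (Space d))))
      (interior (convexHull ℝ (K' : Set (Space d)))) := by
  classical
  rw [Set.disjoint_iff_inter_eq_empty, ← interior_inter, ← Set.not_nonempty_iff_eq_empty]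
  intro hn
  have h1 := hn.mono (interior_mono (𝒯.inter_subset_convexHull hK.1 hK'.1))
  rw [← Finset.coe_inter, interior_convexHull_nonempty_iff_affineSpan_eq_top] at h1
  have hind : AffineIndependent ℝ ((↑) : ((K ∩ K' : Finset (Space d)) : Set (Space d)) → Space d) :=
    (𝒯.indep hK.1).mono (by simp)
  have h2 : Fintype.card ((K ∩ K' : Finset (Space d)) : Set (Space d))
      = Module.finrank ℝ (Space d) + 1 := by
    rw [← hind.affineSpan_eq_top_iff_card_eq_finrank_add_one, Subtype.range_coe]
    exact h1
  rw [finrank_euclideanSpace_fin] at h2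
  have h3 : (K ∩ K').card = d + 1 := by
    rw [← h2, ← Nat.card_eq_fintype_card, Nat.card_coe_set_eq, Set.ncard_coe_finset]
  have h4 : K ∩ K' = K := Finset.eq_of_subset_of_card_le Finset.inter_subset_left
    (by rw [h3, hK.2])
  have h5 : K ∩ K' = K' := Finset.eq_of_subset_of_card_le Finset.inter_subset_right
    (by rw [h3, hK'.2])
  exact hne (h4.symm.trans h5)

lemma restrict_interior_element (K : Finset (Space d)) :
    (volume : Measure (Space d)).restrict (interior (convexHull ℝ (K : Set (Space d))))
      = volume.restrict (convexHull ℝ (K : Set (Space d))) :=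
  Measure.restrict_congr_set
    (interior_ae_eq_of_null_frontier ((convex_convexHull ℝ _).addHaar_frontier volume))

/-- Up to a null set, the domain is the union of the open elements. -/
lemma IsSimplicialPartition.restrict_eq (h𝒯 : IsSimplicialPartition Ω 𝒯) :
    (volume : Measure (Space d)).restrict Ω = volume.restrict
      (⋃ K ∈ h𝒯.finite_elements.toFinset, interior (convexHull ℝ (K : Set (Space d)))) := by
  refine Measure.restrict_congr_set (ae_eq_set.2 ⟨?_, ?_⟩)
  · refine measure_mono_null (t := ⋃ K ∈ elements 𝒯, frontier (convexHull ℝ (K : Set (Space d))))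
      ?_ ?_
    · rintro x ⟨hx, hx'⟩
      obtain ⟨K, hK, hxK⟩ := mem_iUnion₂.1 (h𝒯.subset_iUnion hx)
      refine mem_iUnion₂.2 ⟨K, hK, subset_closure hxK, fun hi => hx' ?_⟩
      exact mem_iUnion₂.2 ⟨K, h𝒯.finite_elements.mem_toFinset.2 hK, hi⟩
    · rw [measure_biUnion_null_iff h𝒯.finite_elements.countable]
      exact fun K _ => (convex_convexHull ℝ _).addHaar_frontier volume
  · rw [sdiff_eq_empty.2, measure_empty]
    exact iUnion₂_subset fun K hK =>
      h𝒯.interior_subset K (h𝒯.finite_elements.mem_toFinset.1 hK)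

lemma IsSimplicialPartition.integral_eq_sum (h𝒯 : IsSimplicialPartition Ω 𝒯) {F : Space d → ℝ}
    (hF : Integrable F (volume.restrict Ω)) :
    ∫ x in Ω, F x = ∑ K ∈ h𝒯.finite_elements.toFinset,
      ∫ x in interior (convexHull ℝ (K : Set (Space d))), F x := by
  rw [h𝒯.restrict_eq] at hF ⊢
  refine integral_biUnion_finset _ (fun K _ => isOpen_interior.measurableSet) ?_ fun K hK => ?_
  · intro K hK K' hK' hne
    rw [SetLike.mem_coe, Set.Finite.mem_toFinset] at hK hK'
    exact disjoint_interior_element hK hK' hne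
  · exact hF.mono_measure (Measure.restrict_mono (subset_biUnion_of_mem
      (u := fun K : Finset (Space d) => interior (convexHull ℝ (K : Set (Space d)))) hK) le_rfl)

lemma hMin_le {K : Finset (Space d)} (hK : K ∈ elements 𝒯) : hMin 𝒯 ≤ elementDiam K := by
  refine csInf_le ⟨0, ?_⟩ (mem_image_of_mem _ hK)
  rintro _ ⟨K', _, rfl⟩
  exact Metric.diam_nonneg

lemma norm_Lp_sq {F : Type*} [NormedAddCommGroup F] [InnerProductSpace ℝ F]
    {μ : Measure (Space d)} (z : Lp F 2 μ) : ‖z‖ ^ 2 = ∫ x, ‖z x‖ ^ 2 ∂μ := by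
  rw [← real_inner_self_eq_norm_sq, L2.inner_def]
  simp only [real_inner_self_eq_norm_sq]

lemma integrable_norm_Lp_sq {F : Type*} [NormedAddCommGroup F]
    {μ : Measure (Space d)} (z : Lp F 2 μ) : Integrable (fun x => ‖z x‖ ^ 2) μ :=
  (Lp.memLp z).integrable_norm_pow (by norm_num)

/-- The inverse estimate on one element, which contains a ball of radius `h / (2 σ)` and is contained
in the concentric ball of radius `h`. -/
lemma element_inverse {σ : ℝ} (hσ : 0 < σ) {p : ℕ} {C : ℝ}
    (hC : ∀ P : MvPolynomial (Fin d) ℝ, P.totalDegree ≤ p → ∀ (x₀ : Space d) (h : ℝ), 0 < h →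
      ∫ x in Metric.closedBall x₀ h, ‖gradient (polyFun P) x‖ ^ 2
        ≤ (C / h) ^ 2 * ∫ x in Metric.closedBall x₀ (h * (1 / (2 * σ))), ‖polyFun P x‖ ^ 2)
    {P : MvPolynomial (Fin d) ℝ} (hP : P.totalDegree ≤ p) {K : Finset (Space d)} {x₀ : Space d}
    (hball : Metric.closedBall x₀ (elementDiam K / (2 * σ)) ⊆ convexHull ℝ (K : Set (Space d)))
    (hh : 0 < elementDiam K) :
    ∫ x in interior (convexHull ℝ (K : Set (Space d))), ‖gradient (polyFun P) x‖ ^ 2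
      ≤ (C / elementDiam K) ^ 2 *
        ∫ x in interior (convexHull ℝ (K : Set (Space d))), ‖polyFun P x‖ ^ 2 := by
  have hx₀ : x₀ ∈ convexHull ℝ (K : Set (Space d)) :=
    hball (Metric.mem_closedBall_self (by positivity))
  have c1 : Continuous fun x => ‖gradient (polyFun P) x‖ ^ 2 :=
    (continuous_gradient (contDiff_polyFun P)).norm.pow 2
  have c2 : Continuous fun x => ‖polyFun P x‖ ^ 2 := (contDiff_polyFun P).continuous.norm.pow 2
  have hsub : interior (convexHull ℝ (K : Set (Space d)))
      ⊆ Metric.closedBall x₀ (elementDiam K) := fun x hx =>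
    Metric.dist_le_diam_of_mem (isCompact_element K).isBounded (interior_subset hx) hx₀
  rw [restrict_interior_element K]
  calc ∫ x in convexHull ℝ (K : Set (Space d)), ‖gradient (polyFun P) x‖ ^ 2
      = ∫ x in interior (convexHull ℝ (K : Set (Space d))), ‖gradient (polyFun P) x‖ ^ 2 := by
        rw [restrict_interior_element K]
    _ ≤ ∫ x in Metric.closedBall x₀ (elementDiam K), ‖gradient (polyFun P) x‖ ^ 2 :=
        setIntegral_mono_set (c1.continuousOn.integrableOn_compact (isCompact_closedBall _ _))
          (ae_of_all _ fun x => by positivity) (LE.le.eventuallyLE hsub)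
    _ ≤ _ := hC P hP x₀ _ hh
    _ ≤ _ := by
        refine mul_le_mul_of_nonneg_left ?_ (sq_nonneg _)
        refine setIntegral_mono_set (c2.continuousOn.integrableOn_compact (isCompact_element K))
          (ae_of_all _ fun x => by positivity) (LE.le.eventuallyLE ?_)
        rwa [mul_one_div]

/-- The inverse estimate in the finite element space. -/
lemma exists_inverse_estimate (d p : ℕ) {σ : ℝ} (hσ : 0 < σ) :
    ∃ C : ℝ, 0 ≤ C ∧ ∀ (Ω : Set (Space d)), IsOpen Ω →
      ∀ 𝒯 : Geometry.SimplicialComplex ℝ (Space d), IsSimplicialPartition Ω 𝒯 →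
      IsShapeRegular σ 𝒯 → 0 < hMin 𝒯 → ∀ v ∈ femSpace Ω 𝒯 p,
      ‖grad v‖ ≤ C / hMin 𝒯 * ‖val v‖ := by
  obtain ⟨C, hC0, hC⟩ := exists_inverse_ball d p (r := 1 / (2 * σ)) (by positivity)
  refine ⟨C, hC0, fun Ω hΩ 𝒯 h𝒯 hreg hmin v hv => ?_⟩
  refine le_of_sq_le_sq ?_ (by positivity)
  rw [mul_pow, norm_Lp_sq, norm_Lp_sq, h𝒯.integral_eq_sum (integrable_norm_Lp_sq _),
    h𝒯.integral_eq_sum (integrable_norm_Lp_sq _), Finset.mul_sum]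
  refine Finset.sum_le_sum fun K hK => ?_
  rw [Set.Finite.mem_toFinset] at hK
  obtain ⟨P, hP, hvP⟩ := hv K hK
  obtain ⟨x₀, hx₀⟩ := hreg K hK
  have hhK := hMin_le hK
  have hhK0 := hmin.trans_le hhK
  have hsub := h𝒯.interior_subset K hK
  have g1 := grad_ae_eq_gradient v isOpen_interior hsub (contDiff_polyFun P)
    (by filter_upwards [hvP] with x hx hxK using hx (interior_subset hxK))
  have e1 : ∫ x in interior (convexHull ℝ (K : Set (Space d))), ‖grad v x‖ ^ 2
      = ∫ x in interior (convexHull ℝ (K : Set (Space d))), ‖gradient (polyFun P) x‖ ^ 2 := by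
    refine integral_congr_ae ?_
    filter_upwards [ae_restrict_of_ae_restrict_of_subset hsub g1,
      ae_restrict_mem isOpen_interior.measurableSet] with x hx hxK
    rw [hx hxK]
  have e2 : ∫ x in interior (convexHull ℝ (K : Set (Space d))), ‖val v x‖ ^ 2
      = ∫ x in interior (convexHull ℝ (K : Set (Space d))), ‖polyFun P x‖ ^ 2 := by
    refine integral_congr_ae ?_
    filter_upwards [ae_restrict_of_ae_restrict_of_subset hsub hvP,
      ae_restrict_mem isOpen_interior.measurableSet] with x hx hxK
    rw [hx (interior_subset hxK)]
    rfl
  rw [e1, e2]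
  refine (element_inverse hσ hC hP hx₀ (hmin.trans_le hhK)).trans ?_
  refine mul_le_mul_of_nonneg_right ?_ (integral_nonneg fun x => by positivity)
  gcongr

/-- The pairs of a function in `H¹₀(Ω)` and a family of polynomials that agree on every element. -/
def representation (Ω : Set (Space d)) (𝒯 : Geometry.SimplicialComplex ℝ (Space d)) :
    Submodule ℝ (H10 Ω × (elements 𝒯 → MvPolynomial (Fin d) ℝ)) where
  carrier := {w | ∀ K : elements 𝒯, ∀ᵐ x ∂(volume.restrict Ω),
    x ∈ convexHull ℝ (K.1 : Set (Space d)) → val w.1 x = polyFun (w.2 K) x}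
  zero_mem' := by
    intro K
    filter_upwards [Lp.coeFn_zero ℝ 2 (volume.restrict Ω)] with x hx _
    refine hx.trans ?_
    simp [polyFun]
  add_mem' := by
    intro w w' hw hw' K
    have h0 : val (w + w').1 = val w.1 + val w'.1 := rfl
    rw [h0]
    filter_upwards [Lp.coeFn_add (val w.1) (val w'.1), hw K, hw' K] with x hx h1 h2 hxK
    rw [hx, Pi.add_apply, h1 hxK, h2 hxK, Prod.snd_add, Pi.add_apply, polyFun_add, Pi.add_apply]
  smul_mem' := by
    intro r w hw K
    have h0 : val (r • w).1 = r • val w.1 := rfl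
    rw [h0]
    filter_upwards [Lp.coeFn_smul r (val w.1), hw K] with x hx h1 hxK
    rw [hx, Pi.smul_apply, h1 hxK, Prod.smul_snd, Pi.smul_apply, polyFun_smul, Pi.smul_apply]

/-- A subspace is finite-dimensional if a linear relation assigns to each of its elements some element
of a finite-dimensional space in such a way that only `0` is related to `0`. -/
lemma finiteDimensional_of_relation {V W : Type*} [AddCommGroup V] [Module ℝ V] [AddCommGroup W]
    [Module ℝ W] [FiniteDimensional ℝ W] (R : Submodule ℝ (V × W))
    (hinj : ∀ v, (v, (0 : W)) ∈ R → v = 0) (S : Submodule ℝ V)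
    (hS : ∀ v ∈ S, ∃ w, (v, w) ∈ R) : FiniteDimensional ℝ S := by
  have h1 : Function.Injective ((LinearMap.snd ℝ V W).comp R.subtype) := by
    rw [← LinearMap.ker_eq_bot, LinearMap.ker_eq_bot']
    rintro ⟨⟨v, w⟩, hvw⟩ hw
    obtain rfl : w = 0 := hw
    exact Subtype.ext (Prod.ext (hinj v hvw) rfl)
  have := Module.Finite.of_injective _ h1
  refine Submodule.finiteDimensional_of_le
    (S₂ := LinearMap.range ((LinearMap.fst ℝ V W).comp R.subtype)) fun v hv => ?_
  obtain ⟨w, hw⟩ := hS v hv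
  exact ⟨⟨(v, w), hw⟩, rfl⟩

/-- The finite element space is finite-dimensional, since a function is determined by the polynomials
that represent it on the elements. -/
lemma finiteDimensional_femSpace (hΩ : IsOpen Ω) (h𝒯 : IsSimplicialPartition Ω 𝒯) (p : ℕ) :
    FiniteDimensional ℝ (femSpace Ω 𝒯 p) := by
  have := h𝒯.finite_elements.to_subtype
  refine finiteDimensional_of_relation
    (W := elements 𝒯 → MvPolynomial.restrictTotalDegree (Fin d) ℝ p)
    ((representation Ω 𝒯).comap (LinearMap.id.prodMap
      (LinearMap.pi fun K => (MvPolynomial.restrictTotalDegree (Fin d) ℝ p).subtype.comp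
        (LinearMap.proj K)))) ?_ _ ?_
  · intro v hv
    have hv' : ∀ K : elements 𝒯, ∀ᵐ x ∂(volume.restrict Ω),
        x ∈ convexHull ℝ (K.1 : Set (Space d)) → val v x = polyFun 0 x := hv
    refine eq_zero_of_val_eq_zero hΩ (Lp.ext ?_)
    have hall := ae_all_iff.2 hv'
    filter_upwards [hall, Lp.coeFn_zero ℝ 2 (volume.restrict Ω),
      ae_restrict_mem hΩ.measurableSet] with x hx h0 hxΩ
    obtain ⟨K, hK, hxK⟩ := mem_iUnion₂.1 (h𝒯.subset_iUnion hxΩ)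
    rw [h0, hx ⟨K, hK⟩ hxK]
    simp [polyFun]
  · intro v hv
    choose P hP hvP using fun K : elements 𝒯 => hv K.1 K.2
    exact ⟨fun K => ⟨P K, (MvPolynomial.mem_restrictTotalDegree _ _ _).2 (hP K)⟩,
      fun K => hvP K⟩

end Mesh

/-! ### Time meshes -/

section TimeMesh

variable {T : ℝ} (t : TimeMesh T)

lemma TimeMesh.N_pos (hT : 0 < T) : 0 < t.N := by
  rcases Nat.eq_zero_or_pos t.N with h | h
  · have h1 := t.node_last
    rw [h, t.node_zero] at h1
    exact absurd h1 hT.ne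
  · exact h

lemma TimeMesh.node_mono {i j : ℕ} (hij : i ≤ j) (hj : j ≤ t.N) : t.node i ≤ t.node j := by
  induction j, hij using Nat.le_induction with
  | base => exact le_rfl
  | succ j _ ih => exact (ih (by omega)).trans (t.node_lt j (by omega)).le

lemma TimeMesh.step_le_maxStep {n : ℕ} (hn : n < t.N) :
    t.node (n + 1) - t.node n ≤ t.maxStep :=
  le_ciSup (f := fun n : Fin t.N => t.node (n + 1) - t.node n) (Set.finite_range _).bddAbove ⟨n, hn⟩

lemma TimeMesh.Ioo_subset {n : ℕ} (hn : n < t.N) :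
    Ioo (t.node n) (t.node (n + 1)) ⊆ Ioo 0 T := by
  have h1 := t.node_mono (Nat.zero_le n) hn.le
  have h2 := t.node_mono (Nat.succ_le_of_lt hn) le_rfl
  rw [t.node_zero] at h1
  rw [t.node_last] at h2
  exact Ioo_subset_Ioo h1 h2

lemma TimeMesh.index_unique {i j : ℕ} (hi : i < t.N) (hj : j < t.N) {s : ℝ}
    (h1 : s ∈ Ioo (t.node i) (t.node (i + 1))) (h2 : s ∈ Ioo (t.node j) (t.node (j + 1))) :
    i = j := by
  rcases lt_trichotomy i j with h | h | h
  · have := t.node_mono (Nat.succ_le_of_lt h) hj.le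
    have := h1.2
    have := h2.1
    linarith
  · exact h
  · have := t.node_mono (Nat.succ_le_of_lt h) hi.le
    have := h2.2
    have := h1.1
    linarith

lemma TimeMesh.ae_mem_interval :
    Ioo 0 T ≤ᵐ[volume] ⋃ n : Fin t.N, Ioo (t.node n) (t.node (n + 1)) := by
  have hnull : ∀ᵐ s : ℝ, ∀ n : ℕ, s ≠ t.node n :=
    ae_all_iff.2 fun n => by simp [ae_iff, measure_singleton]
  filter_upwards [hnull] with s hs hsT
  have hex : ∃ n, s < t.node (n + 1) ∧ n < t.N := by
    refine ⟨t.N - 1, ?_, ?_⟩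
    · have := t.N_pos (hsT.1.trans hsT.2)
      rw [Nat.sub_add_cancel this, t.node_last]
      exact hsT.2
    · have := t.N_pos (hsT.1.trans hsT.2)
      omega
  classical
  obtain ⟨h1, h2⟩ := Nat.find_spec hex
  refine mem_iUnion.2 ⟨⟨Nat.find hex, h2⟩, ?_, h1⟩
  refine lt_of_le_of_ne ?_ (hs _).symm
  rcases Nat.eq_zero_or_eq_succ_pred (Nat.find hex) with h0 | h0
  · rw [show ((⟨Nat.find hex, h2⟩ : Fin t.N) : ℕ) = 0 from h0, t.node_zero]
    exact hsT.1.le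
  · have h3 := Nat.find_min hex (m := (Nat.find hex).pred) (by omega)
    by_contra hlt
    push Not at hlt
    refine h3 ⟨?_, by omega⟩
    rw [← Nat.succ_eq_add_one, ← h0]
    exact hlt

lemma TimeMesh.intervalIntegrable {F : Type*} [NormedAddCommGroup F] {f : ℝ → F}
    (hf : IntegrableOn f (Ioo 0 T) volume) {n : ℕ} (hn : n < t.N) :
    IntervalIntegrable f volume (t.node n) (t.node (n + 1)) := by
  rw [intervalIntegrable_iff_integrableOn_Ioo_of_le (t.node_lt n hn).le]
  exact hf.mono_set (t.Ioo_subset hn)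

lemma TimeMesh.sum_integral (hT : 0 < T) {f : ℝ → ℝ} (hf : IntegrableOn f (Ioo 0 T) volume) :
    ∑ n ∈ Finset.range t.N, ∫ s in (t.node n)..(t.node (n + 1)), f s = ∫ s in Ioo 0 T, f s := by
  rw [intervalIntegral.sum_integral_adjacent_intervals (a := t.node) fun n hn => t.intervalIntegrable hf hn,
    t.node_zero, t.node_last, intervalIntegral.integral_of_le hT.le,
    integral_Ioc_eq_integral_Ioo]

end TimeMesh

/-! ### Marching through the time intervals -/

section Marching

variable {E X Y : Type*} [NormedAddCommGroup E] [NormedSpace ℝ E]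
  [NormedAddCommGroup X] [InnerProductSpace ℝ X] [NormedAddCommGroup Y] [InnerProductSpace ℝ Y]
  {T : ℝ}

/-- The time derivative that enters the interval number `n`: the initial velocity for `n = 0`, the
left limit at `t_n` afterwards. -/
def incomingDeriv (A : E →L[ℝ] X) (m : ℕ) (t : TimeMesh T) (U₀ : X) (α : ℕ → ℕ → E) : ℕ → X
  | 0 => U₀
  | n + 1 => A (polyCurve (m + 1) (diffCoeff (α n)) (t.node (n + 1)))

/-- The gradient that enters the interval number `n`. -/
def incomingGrad (B : E →L[ℝ] Y) (m : ℕ) (t : TimeMesh T) (G₀ : Y) (α : ℕ → ℕ → E) : ℕ → Y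
  | 0 => G₀
  | n + 1 => B (polyCurve (m + 2) (α n) (t.node (n + 1)))

/-- The polynomial curves with coefficients `α n` solve the time steps one after the other. -/
def IsMarching (A : E →L[ℝ] X) (B : E →L[ℝ] Y) (c : ℝ) (m : ℕ) (S : Submodule ℝ E) (t : TimeMesh T)
    (f : ℝ → X) (U₀ : X) (G₀ : Y) (α : ℕ → ℕ → E) : Prop :=
  ∀ n < t.N, ∀ β : ℕ → E, (∀ j, β j ∈ S) →
    localForm A B c m (t.node n) (t.node (n + 1)) (α n) β =
      localLoad A B c m (t.node n) (t.node (n + 1)) f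
        (incomingDeriv A m t U₀ α n) (incomingGrad B m t G₀ α n) β

/-- The step size condition: the inverse estimate holds on `S`, and the Courant number of every step
is small in terms of the constant of `EvalBound`. -/
structure StepCondition (A : E →L[ℝ] X) (B : E →L[ℝ] Y) (c : ℝ) (S : Submodule ℝ E) (t : TimeMesh T)
    (κ K : ℝ) : Prop where
  nonneg : 0 ≤ κ
  inverse : ∀ v ∈ S, ‖B v‖ ≤ κ * ‖A v‖
  le_one : ∀ n < t.N, c * (t.node (n + 1) - t.node n) * κ ≤ 1
  mul_le_half : ∀ n < t.N, K * (c * (t.node (n + 1) - t.node n) * κ) ≤ 1 / 2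

variable {A : E →L[ℝ] X} {B : E →L[ℝ] Y} {c : ℝ} {m : ℕ} {S : Submodule ℝ E} {t : TimeMesh T}
  {f : ℝ → X} {U₀ : X} {G₀ : Y} {κ K : ℝ}

lemma sum_localForm_sub_localLoad (A : E →L[ℝ] X) (B : E →L[ℝ] Y) (c : ℝ) (m : ℕ) (t : TimeMesh T)
    (f : ℝ → X) (x : ℕ → X) (y : ℕ → Y) (α β : ℕ → ℕ → E) :
    ∑ n ∈ Finset.range t.N, (localForm A B c m (t.node n) (t.node (n + 1)) (α n) (β n)
        - localLoad A B c m (t.node n) (t.node (n + 1)) f (x n) (y n) (β n)) =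
      (∑ n ∈ Finset.range t.N, ∫ s in (t.node n)..(t.node (n + 1)),
        inner ℝ (A (polyCurve m (diffCoeff (diffCoeff (α n))) s))
          (A (polyCurve (m + 1) (diffCoeff (β n)) s)))
      + (∑ n ∈ Finset.range t.N,
        inner ℝ (A (polyCurve (m + 1) (diffCoeff (α n)) (t.node n)) - x n)
          (A (polyCurve (m + 1) (diffCoeff (β n)) (t.node n))))
      + c ^ 2 * (∑ n ∈ Finset.range t.N, ∫ s in (t.node n)..(t.node (n + 1)),
        inner ℝ (B (polyCurve (m + 2) (α n) s)) (B (polyCurve (m + 1) (diffCoeff (β n)) s)))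
      + c ^ 2 * (∑ n ∈ Finset.range t.N,
        inner ℝ (B (polyCurve (m + 2) (α n) (t.node n)) - y n)
          (B (polyCurve (m + 2) (β n) (t.node n))))
      - ∑ n ∈ Finset.range t.N, ∫ s in (t.node n)..(t.node (n + 1)),
        inner ℝ (f s) (A (polyCurve (m + 1) (diffCoeff (β n)) s)) := by
  simp only [localForm_sub_localLoad, Finset.sum_sub_distrib, Finset.sum_add_distrib,
    Finset.mul_sum]

lemma exists_isMarching (hc : 0 < c) [FiniteDimensional ℝ S] (hcond : StepCondition A B c S t κ K)
    (hK : EvalBound m K) (hB : ∀ v ∈ S, B v = 0 → v = 0)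
    (hf : IntegrableOn f (Ioo 0 T) volume) (U₀ : X) (G₀ : Y) :
    ∃ α : ℕ → ℕ → E, (∀ n j, α n j ∈ S) ∧ IsMarching A B c m S t f U₀ G₀ α := by
  have hsol : ∀ (n : ℕ) (U : X) (G : Y), ∃ α : ℕ → E, (∀ j, α j ∈ S) ∧
      (n < t.N → ∀ β : ℕ → E, (∀ j, β j ∈ S) →
        localForm A B c m (t.node n) (t.node (n + 1)) α β =
          localLoad A B c m (t.node n) (t.node (n + 1)) f U G β) := by
    intro n U G
    by_cases hn : n < t.N
    · obtain ⟨α, h1, h2⟩ := local_exists hc (t.node_lt n hn) (t.intervalIntegrable hf hn) U G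
        hcond.nonneg hcond.inverse hK (hcond.le_one n hn) (hcond.mul_le_half n hn) hB
      exact ⟨α, h1, fun _ => h2⟩
    · exact ⟨0, fun _ => S.zero_mem, fun h => absurd h hn⟩
  choose sol hsolS hsol using hsol
  -- The recursion feeds the end values of one time step into the next one.
  let α : ℕ → ℕ → E := fun n => Nat.rec (sol 0 U₀ G₀) (fun n a =>
    sol (n + 1) (A (polyCurve (m + 1) (diffCoeff a) (t.node (n + 1))))
      (B (polyCurve (m + 2) a (t.node (n + 1))))) n
  have hα : ∀ n, α n = sol n (incomingDeriv A m t U₀ α n) (incomingGrad B m t G₀ α n) := by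
    intro n
    cases n <;> rfl
  refine ⟨α, fun n j => ?_, fun n hn β hβ => ?_⟩
  · rw [hα n]
    exact hsolS _ _ _ _
  · have h := hsol n (incomingDeriv A m t U₀ α n) (incomingGrad B m t G₀ α n) hn β hβ
    rwa [← hα n] at h

lemma IsMarching.unique (hc : 0 < c) (hcond : StepCondition A B c S t κ K)
    (hK : EvalBound m K) (hB : ∀ v ∈ S, B v = 0 → v = 0) {α α' : ℕ → ℕ → E}
    (hαS : ∀ n j, α n j ∈ S) (hαS' : ∀ n j, α' n j ∈ S)
    (hα : IsMarching A B c m S t f U₀ G₀ α) (hα' : IsMarching A B c m S t f U₀ G₀ α') :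
    ∀ n < t.N, ∀ j < m + 2, α n j = α' n j := by
  intro n
  induction n with
  | zero =>
    intro hn
    exact coeff_eq_of_polyCurve_eq (t.node_lt 0 hn) (local_unique hc (t.node_lt 0 hn) (hαS 0)
      (hαS' 0) (hα 0 hn) (hα' 0 hn) hcond.nonneg hcond.inverse hK (hcond.le_one 0 hn)
      (hcond.mul_le_half 0 hn) hB)
  | succ n ih =>
    intro hn
    have hprev := ih (by omega)
    have h1 : incomingDeriv A m t U₀ α (n + 1) = incomingDeriv A m t U₀ α' (n + 1) := by
      simp only [incomingDeriv]
      rw [polyCurve_congr fun j hj => ?_]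
      rw [diffCoeff, diffCoeff, hprev (j + 1) (by omega)]
    have h2 : incomingGrad B m t G₀ α (n + 1) = incomingGrad B m t G₀ α' (n + 1) := by
      simp only [incomingGrad]
      rw [polyCurve_congr hprev]
    have h3 := hα' (n + 1) hn
    rw [← h1, ← h2] at h3
    exact coeff_eq_of_polyCurve_eq (t.node_lt _ hn) (local_unique hc (t.node_lt _ hn) (hαS _)
      (hαS' _) (hα _ hn) h3 hcond.nonneg hcond.inverse hK (hcond.le_one _ hn)
      (hcond.mul_le_half _ hn) hB)

/-- A bound for energies `E n` and dissipations `D n`: the source enters through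
`F n * (L * √(E n) + 2 * K * F n)`, so that the largest energy can be absorbed. -/
lemma energy_bound {N : ℕ} {En D F : ℕ → ℝ} {K L : ℝ} (hK : 0 ≤ K) (hL : 0 ≤ L)
    (hE0 : ∀ n ≤ N, 0 ≤ En n) (hD0 : ∀ n < N, 0 ≤ D n) (hF0 : ∀ n < N, 0 ≤ F n)
    (hstep : ∀ n < N, En (n + 1) + D n ≤ En n + 2 * (F n * (L * √(En n) + 2 * K * F n))) :
    (∀ n ≤ N, En n ≤ (2 + 4 * L ^ 2 + 8 * K) * (En 0 + (∑ n ∈ Finset.range N, F n) ^ 2)) ∧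
    En N + ∑ n ∈ Finset.range N, D n
      ≤ 2 * (2 + 4 * L ^ 2 + 8 * K) * (En 0 + (∑ n ∈ Finset.range N, F n) ^ 2) := by
  set Ft := ∑ n ∈ Finset.range N, F n with hFt
  have hFt0 : 0 ≤ Ft := Finset.sum_nonneg fun n hn => hF0 n (Finset.mem_range.1 hn)
  -- The square root of the largest energy enters the source term linearly and is absorbed.
  obtain ⟨k, hk, hmax⟩ := Finset.exists_max_image (Finset.range (N + 1)) En ⟨0, by simp⟩
  have hkN : k ≤ N := Nat.lt_succ_iff.1 (Finset.mem_range.1 hk)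
  have hmax' : ∀ n ≤ N, En n ≤ En k := fun n hn => hmax n (Finset.mem_range.2 (by omega))
  set s := √(En k) with hs
  have hs0 : 0 ≤ s := Real.sqrt_nonneg _
  have hs2 : s ^ 2 = En k := Real.sq_sqrt (hE0 k hkN)
  have htel : ∀ n ≤ N, En n + ∑ i ∈ Finset.range n, D i
      ≤ En 0 + 2 * ((∑ i ∈ Finset.range n, F i) * (L * s + 2 * K * Ft)) := by
    intro n
    induction n with
    | zero => simp
    | succ n ih =>
      intro hn
      have hn' : n < N := by omega
      rw [Finset.sum_range_succ, Finset.sum_range_succ]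
      have h1 := ih hn'.le
      have h2 := hstep n hn'
      have h3 : √(En n) ≤ s := Real.sqrt_le_sqrt (hmax' n hn'.le)
      have h4 : F n ≤ Ft := Finset.single_le_sum (f := F)
        (fun i hi => hF0 i (Finset.mem_range.1 hi)) (Finset.mem_range.2 hn')
      have h5 : F n * (L * √(En n) + 2 * K * F n) ≤ F n * (L * s + 2 * K * Ft) := by
        have := hF0 n hn'
        gcongr
      linarith
  have hnn : 0 ≤ L * s + 2 * K * Ft := by positivity
  have hpart : ∀ n ≤ N, ∑ i ∈ Finset.range n, F i ≤ Ft := fun n hn =>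
    Finset.sum_le_sum_of_subset_of_nonneg (Finset.range_mono hn)
      fun i hi _ => hF0 i (Finset.mem_range.1 hi)
  have hall : ∀ n ≤ N, En n + ∑ i ∈ Finset.range n, D i
      ≤ En 0 + 2 * (Ft * (L * s + 2 * K * Ft)) := fun n hn =>
    (htel n hn).trans (by have := mul_le_mul_of_nonneg_right (hpart n hn) hnn; linarith)
  have hDk : 0 ≤ ∑ i ∈ Finset.range k, D i := Finset.sum_nonneg fun i hi =>
    hD0 i ((Finset.mem_range.1 hi).trans_le hkN)
  have hk1 := hall k hkN
  have hE00 := hE0 0 (Nat.zero_le _)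
  have hsbound : s ^ 2 ≤ (2 + 4 * L ^ 2 + 8 * K) * (En 0 + Ft ^ 2) := by
    nlinarith [sq_nonneg (s - 2 * L * Ft), mul_nonneg hK hE00, mul_nonneg (sq_nonneg L) hE00,
      sq_nonneg Ft]
  refine ⟨fun n hn => (hmax' n hn).trans (hs2 ▸ hsbound), (hall N le_rfl).trans ?_⟩
  nlinarith [sq_nonneg (s - L * Ft), mul_nonneg hK hE00, mul_nonneg (sq_nonneg L) hE00,
    sq_nonneg Ft, mul_nonneg hK (sq_nonneg Ft), mul_nonneg (sq_nonneg L) (sq_nonneg Ft)]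

/-- The size of the data. -/
noncomputable def dataNorm (c T : ℝ) (f : ℝ → X) (U₀ : X) (G₀ : Y) : ℝ :=
  (∫ s in Ioo 0 T, ‖f s‖) ^ 2 + ‖U₀‖ ^ 2 + c ^ 2 * ‖G₀‖ ^ 2

/-- The stability constant for energies, in terms of the constant of `EvalBound`. -/
noncomputable def energyConst (K : ℝ) : ℝ := 2 + 4 * (2 * K + 1) ^ 2 + 8 * K

/-- The stability constant for the supremum norms. -/
noncomputable def supConst (K : ℝ) : ℝ := 2 * ((2 * K + 1) ^ 2 * energyConst K + 4 * K ^ 2)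

/-- Bounds by the data for the time derivative and the gradient at all times, and for the final energy
together with all squared jumps: the bounds on single intervals feed `energy_bound`. -/
lemma IsMarching.stability (hT : 0 < T) (hc : 0 < c) (hcond : StepCondition A B c S t κ K)
    (hK0 : 0 ≤ K) (hK : EvalBound m K) {α : ℕ → ℕ → E} (hαS : ∀ n j, α n j ∈ S)
    (hf : IntegrableOn f (Ioo 0 T) volume) (hα : IsMarching A B c m S t f U₀ G₀ α) :
    (∀ n < t.N, ∀ s ∈ Icc (t.node n) (t.node (n + 1)),
      ‖A (polyCurve (m + 1) (diffCoeff (α n)) s)‖ ^ 2 ≤ supConst K * dataNorm c T f U₀ G₀ ∧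
      c ^ 2 * ‖B (polyCurve (m + 2) (α n) s)‖ ^ 2
        ≤ 2 * (energyConst K + supConst K) * dataNorm c T f U₀ G₀) ∧
    ‖incomingDeriv A m t U₀ α t.N‖ ^ 2 + c ^ 2 * ‖incomingGrad B m t G₀ α t.N‖ ^ 2
      + ∑ n ∈ Finset.range t.N,
        (‖A (polyCurve (m + 1) (diffCoeff (α n)) (t.node n)) - incomingDeriv A m t U₀ α n‖ ^ 2
        + c ^ 2 * ‖B (polyCurve (m + 2) (α n) (t.node n)) - incomingGrad B m t G₀ α n‖ ^ 2)
      ≤ 2 * energyConst K * dataNorm c T f U₀ G₀ := by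
  set En : ℕ → ℝ := fun n =>
    ‖incomingDeriv A m t U₀ α n‖ ^ 2 + c ^ 2 * ‖incomingGrad B m t G₀ α n‖ ^ 2 with hEn
  set D : ℕ → ℝ := fun n =>
    ‖A (polyCurve (m + 1) (diffCoeff (α n)) (t.node n)) - incomingDeriv A m t U₀ α n‖ ^ 2
      + c ^ 2 * ‖B (polyCurve (m + 2) (α n) (t.node n)) - incomingGrad B m t G₀ α n‖ ^ 2 with hD
  set F : ℕ → ℝ := fun n => ∫ s in (t.node n)..(t.node (n + 1)), ‖f s‖ with hF
  have hF0 : ∀ n < t.N, 0 ≤ F n := fun n hn =>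
    intervalIntegral.integral_nonneg (t.node_lt n hn).le fun _ _ => norm_nonneg _
  have hE0 : ∀ n, 0 ≤ En n := fun n => by positivity
  have hx : ∀ n, ‖incomingDeriv A m t U₀ α n‖ ≤ √(En n) := fun n =>
    Real.le_sqrt_of_sq_le (le_add_of_nonneg_right (by positivity))
  have hy : ∀ n, c * ‖incomingGrad B m t G₀ α n‖ ≤ √(En n) := fun n =>
    Real.le_sqrt_of_sq_le (by rw [mul_pow]; exact le_add_of_nonneg_left (by positivity))
  have hM : ∀ n < t.N, ∀ s ∈ Icc (t.node n) (t.node (n + 1)),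
      ‖A (polyCurve (m + 1) (diffCoeff (α n)) s)‖
        ≤ (2 * K + 1) * √(En n) + 2 * K * F n := by
    intro n hn s hs
    have h1 := local_deriv_le hc (t.node_lt n hn) (t.intervalIntegrable hf hn) (hαS n) (hα n hn)
      hcond.nonneg hcond.inverse hK (hcond.le_one n hn) (hcond.mul_le_half n hn) s hs
    have h2 := mul_le_mul_of_nonneg_left (hx n) hK0
    have h3 := hy n
    linarith
  have hstep : ∀ n < t.N, En (n + 1) + D n
      ≤ En n + 2 * (F n * ((2 * K + 1) * √(En n) + 2 * K * F n)) := by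
    intro n hn
    have h1 := local_energy (hα n hn (α n) (hαS n))
    have h2 : ‖∫ s in (t.node n)..(t.node (n + 1)),
        (inner ℝ (f s) (A (polyCurve (m + 1) (diffCoeff (α n)) s)) : ℝ)‖
        ≤ ∫ s in (t.node n)..(t.node (n + 1)),
          ‖f s‖ * ((2 * K + 1) * √(En n) + 2 * K * F n) := by
      refine intervalIntegral.norm_integral_le_of_norm_le (t.node_lt n hn).le
        (ae_of_all _ fun s hs => ?_) ((t.intervalIntegrable hf hn).norm.mul_const _)
      exact (norm_inner_le_norm _ _).trans (mul_le_mul_of_nonneg_left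
        (hM n hn s (Ioc_subset_Icc_self hs)) (norm_nonneg _))
    rw [intervalIntegral.integral_mul_const, Real.norm_eq_abs] at h2
    have h3 := (le_abs_self _).trans h2
    have h4 : En (n + 1) + D n = En n + 2 * ∫ s in (t.node n)..(t.node (n + 1)),
        (inner ℝ (f s) (A (polyCurve (m + 1) (diffCoeff (α n)) s)) : ℝ) := h1
    rw [h4]
    linarith
  obtain ⟨b1, b2⟩ := energy_bound (N := t.N) hK0 (L := 2 * K + 1) (by positivity)
    (fun n _ => hE0 n) (fun n _ => by positivity) hF0 hstep
  have hsum : ∑ n ∈ Finset.range t.N, F n = ∫ s in Ioo 0 T, ‖f s‖ := t.sum_integral hT hf.norm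
  have hdata : En 0 + (∑ n ∈ Finset.range t.N, F n) ^ 2 = dataNorm c T f U₀ G₀ := by
    rw [hsum, dataNorm]
    simp only [hEn, incomingDeriv, incomingGrad]
    ring
  rw [hdata] at b1 b2
  refine ⟨fun n hn s hs => ?_, b2⟩
  have hEb : En n ≤ energyConst K * dataNorm c T f U₀ G₀ := b1 n hn.le
  have hFb : F n ^ 2 ≤ dataNorm c T f U₀ G₀ := by
    have h1 : F n ≤ ∫ s in Ioo 0 T, ‖f s‖ := by
      rw [← hsum]
      exact Finset.single_le_sum (f := F)
        (fun i hi => hF0 i (Finset.mem_range.1 hi)) (Finset.mem_range.2 hn)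
    refine (pow_le_pow_left₀ (hF0 n hn) h1 2).trans ?_
    rw [dataNorm, add_assoc]
    exact le_add_of_nonneg_right (by positivity)
  have hsq : √(En n) ^ 2 = En n := Real.sq_sqrt (hE0 n)
  set M := (2 * K + 1) * √(En n) + 2 * K * F n with hMdef
  have hM0 : 0 ≤ M := by have := hF0 n hn; positivity
  have hM2 : M ^ 2 ≤ supConst K * dataNorm c T f U₀ G₀ := by
    calc M ^ 2 ≤ 2 * (((2 * K + 1) * √(En n)) ^ 2 + (2 * K * F n) ^ 2) := add_sq_le
      _ = 2 * ((2 * K + 1) ^ 2 * En n + 4 * K ^ 2 * F n ^ 2) := by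
          rw [mul_pow, hsq]; ring
      _ ≤ 2 * ((2 * K + 1) ^ 2 * (energyConst K * dataNorm c T f U₀ G₀)
          + 4 * K ^ 2 * dataNorm c T f U₀ G₀) := by gcongr
      _ = _ := by rw [supConst]; ring
  refine ⟨(pow_le_pow_left₀ (norm_nonneg _) (hM n hn s hs) 2).trans hM2, ?_⟩
  have hg := local_grad_le hc (t.node_lt n hn) (hαS n) (hα n hn) hcond.nonneg hcond.inverse
    (hM n hn) s hs
  have hg2 : c * ‖B (polyCurve (m + 2) (α n) s)‖ ≤ √(En n) + M := by
    have h1 := mul_le_mul_of_nonneg_right (hcond.le_one n hn) hM0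
    have h2 := hy n
    linarith
  calc c ^ 2 * ‖B (polyCurve (m + 2) (α n) s)‖ ^ 2
      = (c * ‖B (polyCurve (m + 2) (α n) s)‖) ^ 2 := by ring
    _ ≤ (√(En n) + M) ^ 2 := pow_le_pow_left₀ (by positivity) hg2 2
    _ ≤ 2 * (√(En n) ^ 2 + M ^ 2) := add_sq_le
    _ ≤ 2 * (energyConst K * dataNorm c T f U₀ G₀ + supConst K * dataNorm c T f U₀ G₀) := by
        rw [hsq]; gcongr
    _ = _ := by ring

end Marching

/-! ### The scheme in terms of polynomial pieces -/

section OneSided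

variable {V : Type*} [TopologicalSpace V] [T2Space V] {g h : ℝ → V} {a b : ℝ}

lemma rightLim_eq_of_eqOn (hab : a < b) (hgh : EqOn g h (Ioo a b)) (hc : Continuous h) :
    Function.rightLim g a = h a := by
  refine rightLim_eq_of_tendsto (Tendsto.congr' ?_ (hc.continuousWithinAt (s := Ioi a)))
  filter_upwards [Ioo_mem_nhdsGT hab] with s hs using (hgh hs).symm

lemma leftLim_eq_of_eqOn (hab : a < b) (hgh : EqOn g h (Ioo a b)) (hc : Continuous h) :
    Function.leftLim g b = h b := by
  refine leftLim_eq_of_tendsto (Tendsto.congr' ?_ (hc.continuousWithinAt (s := Iio b)))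
  filter_upwards [Ioo_mem_nhdsLT hab] with s hs using (hgh hs).symm

lemma intervalIntegral_congr_Ioo {g h : ℝ → ℝ} (hab : a < b) (hgh : EqOn g h (Ioo a b)) :
    ∫ s in a..b, g s = ∫ s in a..b, h s := by
  rw [intervalIntegral.integral_of_le hab.le, intervalIntegral.integral_of_le hab.le,
    integral_Ioc_eq_integral_Ioo, integral_Ioc_eq_integral_Ioo]
  exact setIntegral_congr_fun measurableSet_Ioo hgh

end OneSided

section Pieces

variable {E : Type*} [NormedAddCommGroup E] [NormedSpace ℝ E] {T : ℝ}

/-- On the interval number `n`, the function `u` is the polynomial curve of degree at most `m + 1`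
with coefficients `α n`. -/
def HasPieces (t : TimeMesh T) (m : ℕ) (α : ℕ → ℕ → E) (u : ℝ → E) : Prop :=
  ∀ n < t.N, EqOn u (polyCurve (m + 2) (α n)) (Ioo (t.node n) (t.node (n + 1)))

lemma exists_hasPieces (t : TimeMesh T) (m : ℕ) (α : ℕ → ℕ → E) :
    ∃ u : ℝ → E, HasPieces t m α u := by
  classical
  refine ⟨fun s => if h : ∃ n < t.N, s ∈ Ioo (t.node n) (t.node (n + 1)) then
    polyCurve (m + 2) (α h.choose) s else 0, fun n hn s hs => ?_⟩
  have hex : ∃ n < t.N, s ∈ Ioo (t.node n) (t.node (n + 1)) := ⟨n, hn, hs⟩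
  simp only [dif_pos hex]
  rw [t.index_unique hex.choose_spec.1 hn hex.choose_spec.2 hs]

variable {t : TimeMesh T} {m : ℕ} {α : ℕ → ℕ → E} {u : ℝ → E}

lemma HasPieces.deriv_eqOn (hu : HasPieces t m α u) {n : ℕ} (hn : n < t.N) :
    EqOn (deriv u) (polyCurve (m + 1) (diffCoeff (α n))) (Ioo (t.node n) (t.node (n + 1))) := by
  intro s hs
  rw [(hu n hn).deriv isOpen_Ioo hs]
  exact (hasDerivAt_polyCurve _ _ _).deriv

lemma HasPieces.deriv_deriv_eqOn (hu : HasPieces t m α u) {n : ℕ} (hn : n < t.N) :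
    EqOn (deriv (deriv u)) (polyCurve m (diffCoeff (diffCoeff (α n))))
      (Ioo (t.node n) (t.node (n + 1))) := by
  intro s hs
  rw [(hu.deriv_eqOn hn).deriv isOpen_Ioo hs]
  exact (hasDerivAt_polyCurve _ _ _).deriv

end Pieces

section Scheme

variable {d : ℕ} {Ω : Set (Space d)} {T : ℝ} {t : TimeMesh T} {m : ℕ} {α β : ℕ → ℕ → H10 Ω}
  {u w : ℝ → H10 Ω}

lemma HasPieces.dtVal_eqOn (hu : HasPieces t m α u) {n : ℕ} (hn : n < t.N) :
    EqOn (dtVal u) (fun s => valL Ω (polyCurve (m + 1) (diffCoeff (α n)) s))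
      (Ioo (t.node n) (t.node (n + 1))) := fun s hs => by
  simp only [dtVal, hu.deriv_eqOn hn hs, valL_apply]

lemma HasPieces.gradCurve_eqOn (hu : HasPieces t m α u) {n : ℕ} (hn : n < t.N) :
    EqOn (gradCurve u) (fun s => gradL Ω (polyCurve (m + 2) (α n) s))
      (Ioo (t.node n) (t.node (n + 1))) := fun s hs => by
  simp only [gradCurve, hu n hn hs, gradL_apply]

lemma HasPieces.rightLim_dtVal (hu : HasPieces t m α u) {n : ℕ} (hn : n < t.N) :
    Function.rightLim (dtVal u) (t.node n)
      = valL Ω (polyCurve (m + 1) (diffCoeff (α n)) (t.node n)) :=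
  rightLim_eq_of_eqOn (t.node_lt n hn) (hu.dtVal_eqOn hn) (by fun_prop)

lemma HasPieces.rightLim_gradCurve (hu : HasPieces t m α u) {n : ℕ} (hn : n < t.N) :
    Function.rightLim (gradCurve u) (t.node n) = gradL Ω (polyCurve (m + 2) (α n) (t.node n)) :=
  rightLim_eq_of_eqOn (t.node_lt n hn) (hu.gradCurve_eqOn hn) (by fun_prop)

/-- At the positive nodes the incoming time derivative is the left limit. -/
lemma HasPieces.leftLim_dtVal (hu : HasPieces t m α u) (v₀ : L2 Ω) {n : ℕ} (hn0 : 1 ≤ n)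
    (hn : n ≤ t.N) :
    Function.leftLim (dtVal u) (t.node n) = incomingDeriv (valL Ω) m t v₀ α n := by
  obtain ⟨k, rfl⟩ := Nat.exists_eq_add_of_le' hn0
  exact leftLim_eq_of_eqOn (t.node_lt k hn) (hu.dtVal_eqOn hn) (by fun_prop)

lemma HasPieces.leftLim_gradCurve (hu : HasPieces t m α u) (g₀ : L2Vec Ω) {n : ℕ} (hn0 : 1 ≤ n)
    (hn : n ≤ t.N) :
    Function.leftLim (gradCurve u) (t.node n) = incomingGrad (gradL Ω) m t g₀ α n := by
  obtain ⟨k, rfl⟩ := Nat.exists_eq_add_of_le' hn0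
  exact leftLim_eq_of_eqOn (t.node_lt k hn) (hu.gradCurve_eqOn hn) (by fun_prop)

lemma sum_range_eq_Ico_add {N : ℕ} (hN : 0 < N) (g : ℕ → ℝ) :
    ∑ n ∈ Finset.range N, g n = ∑ n ∈ Finset.Ico 1 N, g n + g 0 := by
  rw [Finset.range_eq_Ico, Finset.sum_eq_sum_Ico_succ_bot hN, add_comm]

/-- Jump terms with the initial term, when the initial datum `x 0` is counted as the value that enters
the first interval. -/
lemma sum_inner_jump {V : Type*} [NormedAddCommGroup V] [InnerProductSpace ℝ V] (hT : 0 < T)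
    {v w : ℝ → V} {x r z : ℕ → V}
    (hr : ∀ n < t.N, Function.rightLim v (t.node n) = r n)
    (hz : ∀ n < t.N, Function.rightLim w (t.node n) = z n)
    (hx : ∀ n, 1 ≤ n → n ≤ t.N → Function.leftLim v (t.node n) = x n) :
    ∑ n ∈ Finset.Ico 1 t.N, inner ℝ (jump v (t.node n)) (Function.rightLim w (t.node n))
      + inner ℝ (Function.rightLim v 0) (Function.rightLim w 0)
      - inner ℝ (x 0) (Function.rightLim w 0)
    = ∑ n ∈ Finset.range t.N, (inner ℝ (r n - x n) (z n) : ℝ) := by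
  have hN := t.N_pos hT
  have h1 := hr 0 hN
  have h2 := hz 0 hN
  rw [t.node_zero] at h1 h2
  rw [sum_range_eq_Ico_add hN, h1, h2, inner_sub_left, add_sub_assoc]
  congr 1
  refine Finset.sum_congr rfl fun n hn => ?_
  rw [Finset.mem_Ico] at hn
  rw [jump, hr n hn.2, hz n hn.2, hx n hn.1 hn.2.le]

/-- The scheme is the sum of the time steps, when the initial data are counted as what enters the
first interval. -/
lemma bilinForm_sub_linForm (hT : 0 < T) (hu : HasPieces t m α u) (hw : HasPieces t m β w) (c : ℝ)
    (f : ℝ → L2 Ω) (u₀ : H10 Ω) (v₀ : L2 Ω) :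
    bilinForm c t u w - linForm c t f u₀ v₀ w = ∑ n ∈ Finset.range t.N,
      (localForm (valL Ω) (gradL Ω) c m (t.node n) (t.node (n + 1)) (α n) (β n) -
        localLoad (valL Ω) (gradL Ω) c m (t.node n) (t.node (n + 1)) f
          (incomingDeriv (valL Ω) m t v₀ α n) (incomingGrad (gradL Ω) m t (grad u₀) α n) (β n)) := by
  have s1 : ∑ n ∈ Finset.range t.N, (∫ s in (t.node n)..(t.node (n + 1)),
        (inner ℝ (val (deriv (deriv u) s)) (val (deriv w s)) : ℝ))
      = ∑ n ∈ Finset.range t.N, ∫ s in (t.node n)..(t.node (n + 1)),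
        (inner ℝ (valL Ω (polyCurve m (diffCoeff (diffCoeff (α n))) s))
          (valL Ω (polyCurve (m + 1) (diffCoeff (β n)) s)) : ℝ) :=
    Finset.sum_congr rfl fun n hn => by
      rw [Finset.mem_range] at hn
      refine intervalIntegral_congr_Ioo (t.node_lt n hn) fun s hs => ?_
      simp only [hu.deriv_deriv_eqOn hn hs, hw.deriv_eqOn hn hs, valL_apply]
  have s2 : ∑ n ∈ Finset.range t.N, (∫ s in (t.node n)..(t.node (n + 1)),
        (inner ℝ (grad (u s)) (grad (deriv w s)) : ℝ))
      = ∑ n ∈ Finset.range t.N, ∫ s in (t.node n)..(t.node (n + 1)),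
        (inner ℝ (gradL Ω (polyCurve (m + 2) (α n) s))
          (gradL Ω (polyCurve (m + 1) (diffCoeff (β n)) s)) : ℝ) :=
    Finset.sum_congr rfl fun n hn => by
      rw [Finset.mem_range] at hn
      refine intervalIntegral_congr_Ioo (t.node_lt n hn) fun s hs => ?_
      simp only [hu n hn hs, hw.deriv_eqOn hn hs, gradL_apply]
  have s3 : ∑ n ∈ Finset.range t.N, (∫ s in (t.node n)..(t.node (n + 1)),
        (inner ℝ (f s) (val (deriv w s)) : ℝ))
      = ∑ n ∈ Finset.range t.N, ∫ s in (t.node n)..(t.node (n + 1)),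
        (inner ℝ (f s) (valL Ω (polyCurve (m + 1) (diffCoeff (β n)) s)) : ℝ) :=
    Finset.sum_congr rfl fun n hn => by
      rw [Finset.mem_range] at hn
      refine intervalIntegral_congr_Ioo (t.node_lt n hn) fun s hs => ?_
      simp only [hw.deriv_eqOn hn hs, valL_apply]
  have j1 := sum_inner_jump hT (fun n hn => hu.rightLim_dtVal hn)
    (fun n hn => hw.rightLim_dtVal hn) (fun n h1 h2 => hu.leftLim_dtVal v₀ h1 h2)
  have j2 := sum_inner_jump hT (fun n hn => hu.rightLim_gradCurve hn)
    (fun n hn => hw.rightLim_gradCurve hn) (fun n h1 h2 => hu.leftLim_gradCurve (grad u₀) h1 h2)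
  have z1 : incomingDeriv (valL Ω) m t v₀ α 0 = v₀ := rfl
  have z2 : incomingGrad (gradL Ω) m t (grad u₀) α 0 = grad u₀ := rfl
  rw [z1] at j1
  rw [z2] at j2
  have j0 := sum_localForm_sub_localLoad (valL Ω) (gradL Ω) c m t f
    (incomingDeriv (valL Ω) m t v₀ α) (incomingGrad (gradL Ω) m t (grad u₀) α) α β
  unfold bilinForm linForm
  linear_combination s1 + j1 + c ^ 2 * s2 + c ^ 2 * j2 - s3 - j0

variable {𝒯 : Geometry.SimplicialComplex ℝ (Space d)} {p : ℕ}

lemma MemDG.exists_pieces (hu : MemDG 𝒯 p (m + 1) t u) :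
    ∃ α : ℕ → ℕ → H10 Ω, (∀ n j, α n j ∈ femSpace Ω 𝒯 p) ∧ HasPieces t m α u := by
  have h : ∀ n, ∃ a : ℕ → H10 Ω, (∀ j, a j ∈ femSpace Ω 𝒯 p) ∧
      (n < t.N → EqOn u (polyCurve (m + 2) a) (Ioo (t.node n) (t.node (n + 1)))) := by
    intro n
    by_cases hn : n < t.N
    · obtain ⟨a, h1, h2⟩ := hu n hn
      exact ⟨a, h1, fun _ => h2⟩
    · exact ⟨0, fun _ => Submodule.zero_mem _, fun h => absurd h hn⟩
  choose α h1 h2 using h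
  exact ⟨α, h1, h2⟩

lemma HasPieces.memDG (hu : HasPieces t m α u) (hα : ∀ n j, α n j ∈ femSpace Ω 𝒯 p) :
    MemDG 𝒯 p (m + 1) t u :=
  fun n hn => ⟨α n, hα n, hu n hn⟩

/-- A discrete solution is the same as a solution of the successive time steps: test functions that
vanish outside one interval decouple the scheme. -/
lemma HasPieces.isDiscreteSolution_iff (hT : 0 < T) (hu : HasPieces t m α u)
    (hα : ∀ n j, α n j ∈ femSpace Ω 𝒯 p) (c : ℝ) (f : ℝ → L2 Ω) (u₀ : H10 Ω) (v₀ : L2 Ω) :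
    IsDiscreteSolution 𝒯 p (m + 1) c t f u₀ v₀ u ↔
      IsMarching (valL Ω) (gradL Ω) c m (femSpace Ω 𝒯 p) t f v₀ (grad u₀) α := by
  constructor
  · rintro ⟨-, h⟩ k hk β hβ
    have hsingle : ∀ n j, (if n = k then β else 0 : ℕ → H10 Ω) j ∈ femSpace Ω 𝒯 p := by
      intro n j
      by_cases hn : n = k
      · rw [if_pos hn]; exact hβ j
      · rw [if_neg hn]; exact Submodule.zero_mem _
    obtain ⟨w, hw⟩ := exists_hasPieces t m fun n => (if n = k then β else 0 : ℕ → H10 Ω)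
    have h1 := bilinForm_sub_linForm hT hu hw c f u₀ v₀
    have h2 := h w (hw.memDG hsingle)
    rw [Finset.sum_eq_single_of_mem k (Finset.mem_range.2 hk) fun n _ hn => by
      rw [if_neg hn, map_zero, localLoad_zero, sub_zero], if_pos rfl] at h1
    linarith
  · intro h
    refine ⟨hu.memDG hα, fun w hw => ?_⟩
    obtain ⟨β, hβ, hwβ⟩ := hw.exists_pieces
    have h1 := bilinForm_sub_linForm hT hu hwβ c f u₀ v₀
    rw [Finset.sum_eq_zero fun n hn => by
      exact sub_eq_zero.2 (h n (Finset.mem_range.1 hn) (β n) (hβ n))] at h1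
    exact sub_eq_zero.1 h1

/-- A function of time that agrees on every interval with a continuous function bounded by `M` lies
in `L^∞`, with norm at most `M`. -/
lemma memLp_top_of_pieces {V : Type*} [NormedAddCommGroup V] {v : ℝ → V} {h : ℕ → ℝ → V}
    (hc : ∀ n, Continuous (h n))
    (hv : ∀ n < t.N, EqOn v (h n) (Ioo (t.node n) (t.node (n + 1)))) {M : ℝ} (hM0 : 0 ≤ M)
    (hM : ∀ n < t.N, ∀ s ∈ Icc (t.node n) (t.node (n + 1)), ‖h n s‖ ≤ M) :
    MemLp v ∞ (volume.restrict (Ioo 0 T)) ∧ supNorm T v ≤ M := by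
  have hle : (volume : Measure ℝ).restrict (Ioo 0 T)
      ≤ volume.restrict (⋃ n : Fin t.N, Ioo (t.node n) (t.node (n + 1))) :=
    Measure.restrict_mono' t.ae_mem_interval le_rfl
  have hmeas : AEStronglyMeasurable v (volume.restrict (Ioo 0 T)) := by
    refine AEStronglyMeasurable.mono_measure ?_ hle
    rw [aestronglyMeasurable_iUnion_iff]
    intro n
    refine (hc n).aestronglyMeasurable.congr ?_
    filter_upwards [ae_restrict_mem measurableSet_Ioo] with s hs using (hv n n.2 hs).symm
  have hbound : ∀ᵐ s ∂(volume.restrict (Ioo 0 T)), ‖v s‖ ≤ M := by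
    refine ae_mono hle ?_
    filter_upwards [ae_restrict_mem (MeasurableSet.iUnion fun n => measurableSet_Ioo)] with s hs
    obtain ⟨n, hn⟩ := mem_iUnion.1 hs
    rw [hv n n.2 hn]
    exact hM n n.2 s (Ioo_subset_Icc_self hn)
  refine ⟨memLp_top_of_bound hmeas M hbound, ?_⟩
  rw [supNorm, eLpNorm_exponent_top]
  refine ENNReal.toReal_le_of_le_ofReal hM0 ?_
  exact eLpNormEssSup_le_of_ae_bound hbound

/-- The jump seminorm in terms of the jumps relative to the incoming values. -/
lemma jumpSeminormSq_le {V : Type*} [NormedAddCommGroup V] (hT : 0 < T) {v : ℝ → V} {x r : ℕ → V}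
    (hr : ∀ n < t.N, Function.rightLim v (t.node n) = r n)
    (hx : ∀ n, 1 ≤ n → n ≤ t.N → Function.leftLim v (t.node n) = x n) :
    jumpSeminormSq t v
      ≤ ‖x t.N‖ ^ 2 + 2 * ∑ n ∈ Finset.range t.N, ‖r n - x n‖ ^ 2 + 2 * ‖x 0‖ ^ 2 := by
  have hN := t.N_pos hT
  have h1 : ∑ n ∈ Finset.Ico 1 t.N, ‖jump v (t.node n)‖ ^ 2
      = ∑ n ∈ Finset.Ico 1 t.N, ‖r n - x n‖ ^ 2 := Finset.sum_congr rfl fun n hn => by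
    rw [Finset.mem_Ico] at hn
    rw [jump, hr n hn.2, hx n hn.1 hn.2.le]
  have h2 := hx t.N hN le_rfl
  have h3 := hr 0 hN
  rw [t.node_last] at h2
  rw [t.node_zero] at h3
  have h4 : ‖r 0‖ ^ 2 ≤ 2 * (‖r 0 - x 0‖ ^ 2 + ‖x 0‖ ^ 2) := by
    refine (pow_le_pow_left₀ (norm_nonneg _) (?_ : ‖r 0‖ ≤ ‖r 0 - x 0‖ + ‖x 0‖) 2).trans add_sq_le
    simpa using norm_add_le (r 0 - x 0) (x 0)
  have h5 : 0 ≤ ∑ n ∈ Finset.Ico 1 t.N, ‖r n - x n‖ ^ 2 :=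
    Finset.sum_nonneg fun _ _ => by positivity
  rw [jumpSeminormSq, h1, h2, h3, sum_range_eq_Ico_add hN]
  linarith

lemma HasPieces.stability (hT : 0 < T) {c : ℝ} (hc : 0 < c) {κ K : ℝ}
    (hcond : StepCondition (valL Ω) (gradL Ω) c (femSpace Ω 𝒯 p) t κ K)
    (hK0 : 0 ≤ K) (hK : EvalBound m K) (hα : ∀ n j, α n j ∈ femSpace Ω 𝒯 p)
    (hu : HasPieces t m α u) {f : ℝ → L2 Ω} (hf : IntegrableOn f (Ioo 0 T) volume)
    {u₀ : H10 Ω} {v₀ : L2 Ω}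
    (hmarch : IsMarching (valL Ω) (gradL Ω) c m (femSpace Ω 𝒯 p) t f v₀ (grad u₀) α) :
    MemLp (dtVal u) ∞ (volume.restrict (Ioo 0 T)) ∧
    MemLp (gradCurve u) ∞ (volume.restrict (Ioo 0 T)) ∧
    supNorm T (dtVal u) ^ 2 + c ^ 2 * supNorm T (gradCurve u) ^ 2
        + jumpSeminormSq t (dtVal u) + c ^ 2 * jumpSeminormSq t (gradCurve u)
      ≤ (supConst K + 2 * (energyConst K + supConst K) + 4 * energyConst K + 2)
        * dataNorm c T f v₀ (grad u₀) := by
  obtain ⟨hsup, hjump⟩ := hmarch.stability hT hc hcond hK0 hK hα hf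
  set Δ := dataNorm c T f v₀ (grad u₀) with hΔ
  have hΔ0 : 0 ≤ Δ := by rw [hΔ, dataNorm]; positivity
  have hE0 : 0 ≤ energyConst K := by unfold energyConst; positivity
  have hS0 : 0 ≤ supConst K := by unfold supConst; positivity
  obtain ⟨m1, b1⟩ := memLp_top_of_pieces
    (h := fun n s => valL Ω (polyCurve (m + 1) (diffCoeff (α n)) s)) (by fun_prop)
    (fun n hn => hu.dtVal_eqOn hn) (M := √(supConst K * Δ)) (Real.sqrt_nonneg _)
    (fun n hn s hs => Real.le_sqrt_of_sq_le (hsup n hn s hs).1)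
  obtain ⟨m2, b2⟩ := memLp_top_of_pieces
    (h := fun n s => gradL Ω (polyCurve (m + 2) (α n) s)) (by fun_prop)
    (fun n hn => hu.gradCurve_eqOn hn) (M := √(2 * (energyConst K + supConst K) * Δ / c ^ 2))
    (Real.sqrt_nonneg _)
    (fun n hn s hs => Real.le_sqrt_of_sq_le (by
      rw [le_div_iff₀ (by positivity), mul_comm]
      exact (hsup n hn s hs).2))
  refine ⟨m1, m2, ?_⟩
  have e1 : supNorm T (dtVal u) ^ 2 ≤ supConst K * Δ :=
    (pow_le_pow_left₀ ENNReal.toReal_nonneg b1 2).trans_eq (Real.sq_sqrt (by positivity))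
  have e2 : c ^ 2 * supNorm T (gradCurve u) ^ 2 ≤ 2 * (energyConst K + supConst K) * Δ := by
    have := (pow_le_pow_left₀ ENNReal.toReal_nonneg b2 2).trans_eq (Real.sq_sqrt (by positivity))
    rw [le_div_iff₀ (by positivity), mul_comm] at this
    exact this
  have e3 := jumpSeminormSq_le hT (fun n hn => hu.rightLim_dtVal hn)
    (fun n h1 h2 => hu.leftLim_dtVal v₀ h1 h2)
  have e4 := mul_le_mul_of_nonneg_left (jumpSeminormSq_le hT (fun n hn => hu.rightLim_gradCurve hn)
    (fun n h1 h2 => hu.leftLim_gradCurve (grad u₀) h1 h2)) (sq_nonneg c)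
  rw [Finset.sum_add_distrib, ← Finset.mul_sum] at hjump
  have e5 : ‖v₀‖ ^ 2 + c ^ 2 * ‖grad u₀‖ ^ 2 ≤ Δ := by
    rw [hΔ, dataNorm, add_assoc]
    exact le_add_of_nonneg_left (by positivity)
  have z1 : incomingDeriv (valL Ω) m t v₀ α 0 = v₀ := rfl
  have z2 : incomingGrad (gradL Ω) m t (grad u₀) α 0 = grad u₀ := rfl
  rw [z1] at e3
  rw [z2] at e4
  have e6 : 0 ≤ ‖incomingDeriv (valL Ω) m t v₀ α t.N‖ ^ 2
    + c ^ 2 * ‖incomingGrad (gradL Ω) m t (grad u₀) α t.N‖ ^ 2 := by positivity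
  linarith

end Scheme
end DGWave

theorem mainTheorem3 (q : ℕ) (hq : 2 ≤ q) :
    ∃ C : ℝ, 0 < C ∧ ∀ (p : ℕ), 1 ≤ p → ∀ (σ : ℝ), 0 < σ → ∃ C_CFL : ℝ, 0 < C_CFL ∧
      ∀ (d : ℕ), 1 ≤ d → d ≤ 3 →
      ∀ (Ω : Set (DGWave.Space d)), IsOpen Ω → IsConnected Ω →
      ∀ (𝒯 : Geometry.SimplicialComplex ℝ (DGWave.Space d)),
        DGWave.IsSimplicialPartition Ω 𝒯 → DGWave.IsShapeRegular σ 𝒯 →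
      ∀ (c T : ℝ), 0 < c → 0 < T →
      ∀ (t : DGWave.TimeMesh T), t.maxStep ≤ C_CFL * DGWave.hMin 𝒯 / c →
      ∀ (f : ℝ → DGWave.L2 Ω), IntegrableOn f (Ioo 0 T) volume →
      ∀ (u₀ : DGWave.H10 Ω) (v₀ : DGWave.L2 Ω),
        (∀ u : ℝ → DGWave.H10 Ω, DGWave.IsDiscreteSolution 𝒯 p q c t f u₀ v₀ u →
          MemLp (DGWave.dtVal u) ∞ (volume.restrict (Ioo 0 T)) ∧
          MemLp (DGWave.gradCurve u) ∞ (volume.restrict (Ioo 0 T)) ∧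
          DGWave.supNorm T (DGWave.dtVal u) ^ 2
              + c ^ 2 * DGWave.supNorm T (DGWave.gradCurve u) ^ 2
              + DGWave.jumpSeminormSq t (DGWave.dtVal u)
              + c ^ 2 * DGWave.jumpSeminormSq t (DGWave.gradCurve u)
            ≤ C * ((∫ s in Ioo 0 T, ‖f s‖) ^ 2 + ‖v₀‖ ^ 2 + c ^ 2 * ‖DGWave.grad u₀‖ ^ 2)) ∧
        (∃ u : ℝ → DGWave.H10 Ω, DGWave.IsDiscreteSolution 𝒯 p q c t f u₀ v₀ u ∧
          ∀ u' : ℝ → DGWave.H10 Ω, DGWave.IsDiscreteSolution 𝒯 p q c t f u₀ v₀ u' →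
            ∀ n < t.N, EqOn u' u (Ioo (t.node n) (t.node (n + 1)))) := by
  obtain ⟨m, rfl⟩ : ∃ m, q = m + 1 := ⟨q - 1, by omega⟩
  obtain ⟨K, hK0, hK⟩ := DGWave.exists_evalBound m
  have hE0 : 0 ≤ DGWave.energyConst K := by unfold DGWave.energyConst; positivity
  have hS0 : 0 ≤ DGWave.supConst K := by unfold DGWave.supConst; positivity
  refine ⟨DGWave.supConst K + 2 * (DGWave.energyConst K + DGWave.supConst K)
    + 4 * DGWave.energyConst K + 2, by positivity, fun p _ σ hσ => ?_⟩
  choose Ci hCi0 hCi using fun d => DGWave.exists_inverse_estimate d p hσ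
  -- One constant that serves for all dimensions `d ≤ 3`.
  set Cmax := ∑ d ∈ Finset.range 4, Ci d + 1 with hCmax
  have hsum0 : 0 ≤ ∑ d ∈ Finset.range 4, Ci d := Finset.sum_nonneg fun d _ => hCi0 d
  have hCmax0 : 0 < Cmax := by positivity
  -- With this choice the Courant number `ε` of a step satisfies `(2 K + 1) ε ≤ 1`, hence `ε ≤ 1` and
  -- `K ε ≤ 1 / 2`.
  refine ⟨1 / ((2 * K + 1) * Cmax), by positivity, ?_⟩
  intro d hd1 hd3 Ω hΩ _ 𝒯 h𝒯 hreg c T hc hT t ht f hf u₀ v₀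
  have hN := t.N_pos hT
  have hstep0 : 0 < t.maxStep :=
    (sub_pos.2 (t.node_lt 0 hN)).trans_le (t.step_le_maxStep hN)
  -- Time steps are positive, so the step size condition excludes the junk value `hMin 𝒯 = 0`.
  have hmin : 0 < DGWave.hMin 𝒯 := by
    have h1 := hstep0.trans_le ht
    by_contra hle
    push Not at hle
    refine h1.not_ge (div_nonpos_of_nonpos_of_nonneg ?_ hc.le)
    exact mul_nonpos_of_nonneg_of_nonpos (by positivity) hle
  have hCd : Ci d ≤ Cmax := by
    have := Finset.single_le_sum (f := Ci) (fun i _ => hCi0 i)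
      (Finset.mem_range.2 (by omega : d < 4))
    linarith
  set κ := Ci d / DGWave.hMin 𝒯 with hκ
  have hκ0 : 0 ≤ κ := div_nonneg (hCi0 d) hmin.le
  have hκC : κ ≤ Cmax / DGWave.hMin 𝒯 := by rw [hκ]; gcongr
  have hε : ∀ n < t.N, (2 * K + 1) * (c * (t.node (n + 1) - t.node n) * κ) ≤ 1 := by
    intro n hn
    have h1 := (t.step_le_maxStep hn).trans ht
    have h2 := sub_pos.2 (t.node_lt n hn)
    calc (2 * K + 1) * (c * (t.node (n + 1) - t.node n) * κ)
        ≤ (2 * K + 1) * (c * (1 / ((2 * K + 1) * Cmax) * DGWave.hMin 𝒯 / c)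
            * (Cmax / DGWave.hMin 𝒯)) := by
          gcongr
      _ = 1 := by field_simp
  have hcond : DGWave.StepCondition (DGWave.valL Ω) (DGWave.gradL Ω) c
      (DGWave.femSpace Ω 𝒯 p) t κ K := by
    refine ⟨hκ0, fun v hv => hCi d Ω hΩ 𝒯 h𝒯 hreg hmin v hv, fun n hn => ?_, fun n hn => ?_⟩
    all_goals
      have h1 := hε n hn
      have h2 : 0 ≤ c * (t.node (n + 1) - t.node n) * κ := by
        have := sub_pos.2 (t.node_lt n hn)
        positivity
      nlinarith [mul_nonneg hK0.le h2]
  have hB : ∀ v ∈ DGWave.femSpace Ω 𝒯 p, DGWave.gradL Ω v = 0 → v = 0 := fun v _ hv =>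
    DGWave.eq_zero_of_grad_eq_zero hΩ h𝒯.isBounded hd1 hv
  have := DGWave.finiteDimensional_femSpace hΩ h𝒯 p
  refine ⟨fun u hu => ?_, ?_⟩
  · obtain ⟨α, hα, hup⟩ := hu.1.exists_pieces
    exact hup.stability hT hc hcond hK0.le hK hα hf
      ((hup.isDiscreteSolution_iff hT hα c f u₀ v₀).1 hu)
  · obtain ⟨α, hα, hmarch⟩ :=
      DGWave.exists_isMarching hc hcond hK hB hf v₀ (DGWave.grad u₀)
    obtain ⟨u, hu⟩ := DGWave.exists_hasPieces t m α
    refine ⟨u, (hu.isDiscreteSolution_iff hT hα c f u₀ v₀).2 hmarch, fun u' hu' n hn s hs => ?_⟩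
    obtain ⟨α', hα', hup'⟩ := hu'.1.exists_pieces
    have hmarch' := (hup'.isDiscreteSolution_iff hT hα' c f u₀ v₀).1 hu'
    rw [hup' n hn hs, hu n hn hs]
    exact DGWave.polyCurve_congr
      (hmarch'.unique hc hcond hK hB hα' hα hmarch n hn) s
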